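/- Let $G=(V,E)$ be a finite connected unit disk graph (nodes placed in the Euclidean plane, two distinct nodes adjacent iff their distance is at most $1$), let $A:V\to\{1,\dots,k\}$ assign to each node its reception channel, and let $s\in V$ be the source. Write $L_i$ for the set of nodes at distance $i$ from $s$ (the layers of a shortest-path tree), $l=\max_v \mathrm{dist}(s,v)$ for its depth, and $L_{i,c}=\{v\in L_i: A(v)=c\}$. A *schedule* says which nodes transmit on which channels in each time slot $1,2,\dots$. In a slot, $v$ *receives from $u$ without collision* if $u$ is a neighbour of $v$ that transmits on channel $A(v)$, $v$ does not transmit, and no other neighbour of $v$ transmits on channel $A(v)$. A *broadcast schedule of length $T$* uses only the slots $1,\dots,T$, lets every node transmit on at most one channel per slot and only if it is $s$ or has received without collision in an earlier slot, and gives every node other than $s$ a collision-free reception by the end of slot $T$. The Enhanced Transmission Scheduling (ETS) algorithm works as follows (ties are broken arbitrarily). *Tree.* For $1\le i\le l$ and each channel $c$, the dominators $M_{i,c}\subseteq L_{i,c}$ are chosen one by one: as long as some node of $L_{i,c}$ is neither a dominator nor has a parent, among these nodes one, $u$, with the largest number of such neighbours becomes a dominator and the parent of these neighbours. Then connectors $P_{i,c}\subseteq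 L_{i-1}$ are chosen one by one: as long as some node of $M_{i,c}$ has no parent, a node of $L_{i-1}$ with the largest number of neighbours in $M_{i,c}$ without a parent becomes a connector and the parent of these neighbours. *Scheduling.* Each chosen $u\in P_{i,c}$ or $u\in M_{i,c}$ transmits once on channel $c$ in that role, to the children it obtained in that role. For $i=1,\dots,l$, for $c=1,\dots,k$, first the nodes of $P_{i,c}$ and then those of $M_{i,c}$, in the order of their selection, are given the smallest slot $t$ that is larger than the reception time of $u$ ($0$ for $s$) and collision-free with respect to the transmissions scheduled before: no neighbour of $u$ with reception channel $c$ is scheduled to receive from its parent in slot $t$, no child served has another neighbour transmitting on channel $c$ in slot $t$, and $u$ does not transmit on another channel in slot $t$. The children served then have reception time $t$. The latency $T_{\mathrm{ETS}}$ is the largest slot used. Then, however the ties are broken, ETS is correct: the parent relation is a spanning tree of $G$, every node other than $s$ is served by exactly one scheduled transmission and receives it without collision, and the output is a broadcast schedule of length $T_{\mathrm{ETS}}$. If $t_i$ denotes the last slot in which a node of $L_i$ transmits ($0$ if there is none), then for $i\ge 1$ the nodes of $M_{i,c}$ transmit as dominators no later than $t_{i-1}+20$, and the nodes of $P_{i+1,c}\subseteq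 L_i$ transmit as connectors no later than $t_{i-1}+k+23$. Moreover $$T_{\mathrm{ETS}}\le (k+23)\,l,$$ and ETS has approximation ratio $k+23$: $T_{\mathrm{ETS}}\le (k+23)\,T$ for every broadcast schedule of length $T$. -/

import Mathlib

namespace ETS

section Model

variable {V : Type*} {k : ℕ}

/-- A unit disk graph: the nodes can be placed in the Euclidean plane so that two distinct nodes
are adjacent exactly when they are at distance at most one. -/
def IsUnitDiskGraph (G : SimpleGraph V) : Prop :=
  ∃ pos : V → EuclideanSpace ℝ (Fin 2), ∀ u v, G.Adj u v ↔ u ≠ v ∧ dist (pos u) (pos v) ≤ 1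

/-- A schedule: `S t` is the set of pairs (node, channel) that transmit in slot `t`. -/
abbrev Schedule (V : Type*) (k : ℕ) : Type _ := ℕ → Set (V × Fin k)

/-- In slot `t`, node `v` receives the transmission of `u` without collision: `u` is a neighbour of
`v` transmitting on the reception channel `A v`, the single radio of `v` is not transmitting,
and no other neighbour of `v` transmits on the channel `A v`. -/
def Receives (G : SimpleGraph V) (A : V → Fin k) (S : Schedule V k) (t : ℕ) (u v : V) : Prop :=
  G.Adj u v ∧ (u, A v) ∈ S t ∧ (∀ c, (v, c) ∉ S t) ∧
    ∀ x, G.Adj x v → (x, A v) ∈ S t → x = u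

/-- `v` holds the message of the source `s` before slot `t` begins. -/
def InformedBefore (G : SimpleGraph V) (A : V → Fin k) (s : V) (S : Schedule V k)
    (t : ℕ) (v : V) : Prop :=
  v = s ∨ ∃ r < t, ∃ u, Receives G A S r u v

/-- `S` is a broadcast schedule from `s` of length `T`: it uses only the slots `1, …, T`, a node
transmits on at most one channel in a slot and only if it already holds the message, and after
slot `T` every node other than the source has had a collision-free reception. -/
structure IsBroadcastSchedule (G : SimpleGraph V) (A : V → Fin k) (s : V) (S : Schedule V k)
    (T : ℕ) : Prop where
  slots : ∀ t x, x ∈ S t → 1 ≤ t ∧ t ≤ T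
  single_radio : ∀ t u c d, (u, c) ∈ S t → (u, d) ∈ S t → c = d
  causal : ∀ t u c, (u, c) ∈ S t → InformedBefore G A s S t u
  complete : ∀ v, InformedBefore G A s S (T + 1) v

end Model

section Algorithm

open scoped Classical

/-- The elements of `S` that maximise `f` on `S`. -/
noncomputable def argmaxSet {V : Type*} (S : Finset V) (f : V → ℕ) : Finset V :=
  S.filter fun u => ∀ v ∈ S, f v ≤ f u

theorem argmaxSet_nonempty {V : Type*} {S : Finset V} (f : V → ℕ) (h : S.Nonempty) :
    (argmaxSet S f).Nonempty := by
  obtain ⟨u, hu, hmax⟩ := S.exists_max_image f h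
  exact ⟨u, Finset.mem_filter.2 ⟨hu, hmax⟩⟩

theorem argmaxSet_subset {V : Type*} (S : Finset V) (f : V → ℕ) : argmaxSet S f ⊆ S :=
  Finset.filter_subset _ _

/-- A rule that breaks the ties in the greedy choices. Given the set `U` of nodes that are
still uncovered and the set `S` of best candidates, it picks one of the latter. -/
structure TieBreak (V : Type*) where
  pick : Finset V → Finset V → V
  pick_mem : ∀ U S, S.Nonempty → pick U S ∈ S

instance {V : Type*} [Nonempty V] : Nonempty (TieBreak V) :=
  ⟨⟨fun _ S => if h : S.Nonempty then h.choose else Classical.arbitrary V, fun _ S h => by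
    simpa [h] using h.choose_spec⟩⟩

/-- A planned transmission: `node` transmits on the channel `chan`, and is responsible for
delivering the message to the nodes in `targets` (its children in the broadcast tree). -/
structure Tx (V : Type*) (k : ℕ) where
  node : V
  chan : Fin k
  targets : Finset V

variable {V : Type*} [Fintype V] {k : ℕ}

/-- Layer `i` of a shortest-path tree rooted at `s`: the nodes at distance `i` from `s`. -/
noncomputable def layer (G : SimpleGraph V) (s : V) (i : ℕ) : Finset V :=
  Finset.univ.filter fun v => G.dist s v = i

/-- The nodes of layer `i` whose reception channel is `c`. -/
noncomputable def layerCh (G : SimpleGraph V) (A : V → Fin k) (s : V) (i : ℕ) (c : Fin k) :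
    Finset V :=
  (layer G s i).filter fun v => A v = c

/-- The depth `l` of a shortest-path tree rooted at `s`. -/
noncomputable def depth (G : SimpleGraph V) (s : V) : ℕ :=
  Finset.univ.sup fun v => G.dist s v

/-- The neighbours of `u` that lie in `U`. -/
noncomputable def nbrsIn {V : Type*} (G : SimpleGraph V) (u : V) (U : Finset V) : Finset V :=
  U.filter fun w => G.Adj u w

/-- Greedy choice of dominators. `U` is the set of nodes that are not yet dominated. While it is
not empty, an undominated node `u` with the largest number of undominated neighbours becomes
a dominator, and is made the parent of these neighbours. -/
noncomputable def dominate {V : Type*} (G : SimpleGraph V) (τ : TieBreak V) (c : Fin k)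
    (U : Finset V) : List (Tx V k) :=
  if h : U.Nonempty then
    let u := τ.pick U (argmaxSet U fun v => (nbrsIn G v U).card)
    have _hu : u ∈ U :=
      argmaxSet_subset _ _ (τ.pick_mem _ _ (argmaxSet_nonempty _ h))
    ⟨u, c, nbrsIn G u U⟩ :: dominate G τ c (U \ insert u (nbrsIn G u U))
  else []
termination_by U.card
decreasing_by
  exact Finset.card_lt_card (Finset.ssubset_iff_subset_ne.2 ⟨Finset.sdiff_subset, fun he => by
    have h1 := _hu
    rw [← he] at h1
    exact (Finset.mem_sdiff.1 h1).2 (Finset.mem_insert_self _ _)⟩)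

/-- Greedy choice of connectors among the nodes of `R`. `U` is the set of nodes that have no parent
yet. As long as some node of `R` has a neighbour in `U`, a node `u ∈ R` with the largest number
of neighbours in `U` becomes a connector, and is made the parent of these neighbours.
(If every node of `U` has a neighbour in `R`, as is the case for consecutive layers, then the loop
stops exactly when every node has a parent.) -/
noncomputable def connect {V : Type*} (G : SimpleGraph V) (τ : TieBreak V) (c : Fin k)
    (R U : Finset V) : List (Tx V k) :=
  if h : ∃ v ∈ R, (nbrsIn G v U).Nonempty then
    let u := τ.pick U (argmaxSet R fun v => (nbrsIn G v U).card)
    have _hu : (nbrsIn G u U).Nonempty := by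
      obtain ⟨v, hv, hne⟩ := h
      have hm := τ.pick_mem U (argmaxSet R fun v => (nbrsIn G v U).card)
        (argmaxSet_nonempty _ ⟨v, hv⟩)
      exact Finset.card_pos.1 ((Finset.card_pos.2 hne).trans_le ((Finset.mem_filter.1 hm).2 v hv))
    ⟨u, c, nbrsIn G u U⟩ :: connect G τ c R (U \ nbrsIn G u U)
  else []
termination_by U.card
decreasing_by
  obtain ⟨w, hw⟩ := _hu
  exact Finset.card_lt_card (Finset.ssubset_iff_subset_ne.2 ⟨Finset.sdiff_subset, fun he => by
    have h1 := (Finset.mem_filter.1 hw).1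
    rw [← he] at h1
    exact (Finset.mem_sdiff.1 h1).2 hw⟩)

/-- The dominators of layer `i` on channel `c`, in the order of their selection. -/
noncomputable def dominators (G : SimpleGraph V) (A : V → Fin k) (s : V) (τ : TieBreak V)
    (i : ℕ) (c : Fin k) : List (Tx V k) :=
  dominate G τ c (layerCh G A s i c)

/-- The connectors in layer `i` that cover the dominators of layer `i + 1` on channel `c`,
in the order of their selection. -/
noncomputable def connectors (G : SimpleGraph V) (A : V → Fin k) (s : V) (τ : TieBreak V)
    (i : ℕ) (c : Fin k) : List (Tx V k) :=
  connect G τ c (layer G s i) ((dominators G A s τ (i + 1) c).map Tx.node).toFinset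

/-- All planned transmissions, in the order in which they are scheduled: layer by layer, channel by
channel, and for each layer and channel first the connectors and then the dominators. -/
noncomputable def plan (G : SimpleGraph V) (A : V → Fin k) (s : V) (τ : TieBreak V) :
    List (Tx V k) :=
  (List.range (depth G s)).flatMap fun i =>
    (List.finRange k).flatMap fun c =>
      connectors G A s τ i c ++ dominators G A s τ (i + 1) c

/-- The broadcast tree: every node is joined to the nodes whose parent it is. -/
def tree (G : SimpleGraph V) (A : V → Fin k) (s : V) (τ : TieBreak V) : SimpleGraph V :=
  SimpleGraph.fromRel fun u v => ∃ J ∈ plan G A s τ, J.node = u ∧ v ∈ J.targets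

/-- The state of the scheduler: the reception times (`⊤` for a node that is not yet covered) and
the list of the transmissions scheduled so far, with their slots. -/
structure State (V : Type*) (k : ℕ) where
  rcv : V → ℕ∞
  log : List (Tx V k × ℕ)

/-- Slot `t` is free for the planned transmission `J`: the transmitter has received the message
before `t`; no neighbour listening on the channel of `J` is already scheduled to receive in slot
`t`; no other node already scheduled in slot `t` on this channel is heard by a target of `J`;
and the transmitter does not use another channel in slot `t`. -/
def SlotFree {V : Type*} (G : SimpleGraph V) (A : V → Fin k) (st : State V k) (J : Tx V k)
    (t : ℕ) : Prop :=
  st.rcv J.node < (t : ℕ∞) ∧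
  (∀ w, G.Adj J.node w → A w = J.chan → st.rcv w ≠ (t : ℕ∞)) ∧
  (∀ v ∈ J.targets, ∀ e ∈ st.log, e.2 = t → e.1.chan = J.chan → e.1.node ≠ J.node →
    ¬ G.Adj e.1.node v) ∧
  (∀ e ∈ st.log, e.1.node = J.node → e.1.chan ≠ J.chan → e.2 ≠ t)

/-- The earliest slot that is free for `J`. -/
noncomputable def earliestSlot {V : Type*} (G : SimpleGraph V) (A : V → Fin k) (st : State V k)
    (J : Tx V k) : ℕ :=
  sInf {t | SlotFree G A st J t}

/-- Schedule `J` in its earliest free slot, and record the reception time of its targets. -/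
noncomputable def step {V : Type*} (G : SimpleGraph V) (A : V → Fin k) (st : State V k)
    (J : Tx V k) : State V k where
  rcv v := if v ∈ J.targets then (earliestSlot G A st J : ℕ∞) else st.rcv v
  log := st.log ++ [(J, earliestSlot G A st J)]

/-- The initial state: only the source has the message, at time `0`. -/
noncomputable def init {V : Type*} (k : ℕ) (s : V) : State V k where
  rcv v := if v = s then 0 else ⊤
  log := []

/-- The output of the algorithm: the planned transmissions, each with its slot. -/
noncomputable def output (G : SimpleGraph V) (A : V → Fin k) (s : V) (τ : TieBreak V) :
    List (Tx V k × ℕ) :=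
  ((plan G A s τ).foldl (step G A) (init k s)).log

/-- The schedule computed by the algorithm. -/
def schedule (G : SimpleGraph V) (A : V → Fin k) (s : V) (τ : TieBreak V) : Schedule V k :=
  fun t => {x | ∃ e ∈ output G A s τ, e.2 = t ∧ e.1.node = x.1 ∧ e.1.chan = x.2}

/-- The largest slot in a list of scheduled transmissions (`0` if there is none). -/
def lastSlot {V : Type*} (L : List (Tx V k × ℕ)) : ℕ :=
  (L.map Prod.snd).foldr max 0

/-- The broadcast latency of the algorithm: the largest slot in which a node transmits. -/
noncomputable def latency (G : SimpleGraph V) (A : V → Fin k) (s : V) (τ : TieBreak V) : ℕ :=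
  lastSlot (output G A s τ)

/-- The time at which all transmitting nodes of layer `i` have finished their transmissions. -/
noncomputable def finishTime (G : SimpleGraph V) (A : V → Fin k) (s : V) (τ : TieBreak V)
    (i : ℕ) : ℕ :=
  lastSlot ((output G A s τ).filter fun e => e.1.node ∈ layer G s i)

end Algorithm

end ETS

/-! The lower bound is the depth: in any broadcast schedule the message advances at most one hop per
slot, so `T ≥ l`. It therefore suffices to bound ETS by `k + 23` slots per layer.

Correctness rests on the plan being well ordered. Target sets of planned transmissions are disjoint
and cover everything but the source, and a transmitter is served earlier in the plan than it
transmits. Of two transmissions that could collide at a target, the one placed second was tested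
against the first: `SlotFree` protects both the receptions already fixed and the new targets.

For the latency, one counts the slots that can be blocked. After `finishTime i`, a dominator of
layer `i + 1` on channel `c` is disturbed only by earlier dominators of the same layer and channel
at two hops. These are mutually non-adjacent, and a node of layer `i - 1` can be added to them, so
packing in the annulus `1 < r ≤ 2` leaves at most 20 - 1 = 19 of them and slot 19 + 1 is reached at
the latest. After `finishTime i + 20`, a connector of layer `i + 1` is disturbed only by at most
three connectors on its channel (five independent neighbours fit in a unit disk; one is a node of
layer `i`, one its own child) and by its own transmissions on `k - 1` other channels: 20 + 3 + (k -
1) + 1 = k + 23. The source needs at most `k` slots, and the last layer has dominators only, so the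
initial `k` is absorbed by the last round.

The main carriers are `card_le_twenty`, `card_le_five`, `Before`, `receives_schedule`,
`dominator_slot_le` and `connector_slot_le`. -/

namespace ETS

/-! ### Packing points at mutual distance greater than one in a disk and in an annulus. -/

section Geometry

open Real

/-- If the directions `θ x` are pairwise more than `2π / n` apart on the circle, then there are
fewer than `n` of them. -/
theorem card_lt_of_cos_sub_lt {ι : Type*} (S : Finset ι) (θ : ι → ℝ) {n : ℕ} (hn : 2 ≤ n)
    (h : ∀ x ∈ S, ∀ y ∈ S, x ≠ y → cos (θ x - θ y) < cos (2 * π / n)) : S.card < n := by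
  rcases S.eq_empty_or_nonempty with rfl | ⟨x₀, hx₀⟩
  · simp; omega
  have hn2 : (2 : ℝ) ≤ n := by exact_mod_cast hn
  have hn0 : (0 : ℝ) < n := by linarith
  set δ : ℝ := 2 * π / n with hδ
  have hδ0 : 0 < δ := by positivity
  have hnδ : n * δ = 2 * π := by rw [hδ]; field_simp
  have hδπ : δ ≤ π := by nlinarith
  set φ : ι → ℝ := fun x => toIcoMod two_pi_pos 0 (θ x - θ x₀) with hφ
  have hφ0 : ∀ x, 0 ≤ φ x := fun x => left_le_toIcoMod two_pi_pos 0 _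
  have hφ1 : ∀ x, φ x < 2 * π := fun x => by
    simpa using toIcoMod_lt_right two_pi_pos 0 (θ x - θ x₀)
  have hφe : ∀ x, ∃ m : ℤ, φ x = θ x - θ x₀ - m * (2 * π) := fun x =>
    ⟨toIcoDiv two_pi_pos 0 (θ x - θ x₀), by
      have := self_sub_toIcoDiv_zsmul two_pi_pos 0 (θ x - θ x₀)
      simp only [hφ, ← this, zsmul_eq_mul]⟩
  have hcos : ∀ x y, cos (φ x - φ y) = cos (θ x - θ y) := fun x y => by
    obtain ⟨a, ha⟩ := hφe x
    obtain ⟨b, hb⟩ := hφe y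
    rw [ha, hb, show θ x - θ x₀ - a * (2 * π) - (θ y - θ x₀ - b * (2 * π))
      = (θ x - θ y) - ((a - b : ℤ) : ℝ) * (2 * π) by push_cast; ring, cos_sub_int_mul_two_pi]
  have hz : φ x₀ = 0 := by
    simp only [hφ, sub_self]
    exact (toIcoMod_eq_self two_pi_pos).2 ⟨le_rfl, by simpa using two_pi_pos⟩
  -- Cut the circle at `x₀` into `n` sectors of width `δ`. The last one is empty, since its points
  -- are within `δ` of `x₀` across the cut.
  have hlt : ∀ x ∈ S, φ x < (n - 1) * δ := fun x hx => by
    by_contra hge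
    push Not at hge
    rcases eq_or_ne x x₀ with rfl | hne
    · rw [hz] at hge; nlinarith
    have h1 := h x hx x₀ hx₀ hne
    rw [← hcos, hz, sub_zero, ← cos_two_pi_sub (φ x)] at h1
    exact absurd h1 (not_lt.2 (cos_le_cos_of_nonneg_of_le_pi (by linarith [hφ1 x]) hδπ
      (by nlinarith)))
  have hmaps : Set.MapsTo (fun x => ⌊φ x / δ⌋₊) (S : Set ι) (Finset.range (n - 1) : Finset ℕ) := by
    intro x hx
    simp only [Finset.coe_range, Set.mem_Iio]
    rw [Nat.floor_lt (div_nonneg (hφ0 x) hδ0.le), div_lt_iff₀ hδ0, Nat.cast_sub (by omega)]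
    simpa using hlt x hx
  -- Each of the remaining `n - 1` sectors holds at most one direction.
  have hinj : Set.InjOn (fun x => ⌊φ x / δ⌋₊) (S : Set ι) := by
    intro x hx y hy hxy
    by_contra hne
    have h1 := h x hx y hy hne
    rw [← hcos, ← cos_abs] at h1
    refine absurd h1 (not_lt.2 (cos_le_cos_of_nonneg_of_le_pi (abs_nonneg _) hδπ ?_))
    have hx1 := Nat.floor_le (div_nonneg (hφ0 x) hδ0.le)
    have hx2 := Nat.lt_floor_add_one (φ x / δ)
    have hy1 := Nat.floor_le (div_nonneg (hφ0 y) hδ0.le)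
    have hy2 := Nat.lt_floor_add_one (φ y / δ)
    simp only at hxy
    rw [hxy] at hx1 hx2
    rw [le_div_iff₀ hδ0] at hx1 hy1
    rw [div_lt_iff₀ hδ0] at hx2 hy2
    rw [abs_le]
    constructor <;> nlinarith
  have := Finset.card_le_card_of_injOn _ hmaps hinj
  rw [Finset.card_range] at this
  omega

/-- Law of cosines; at `z = 0` the default value of `arg` is harmless because it is multiplied by
the norm. -/
theorem norm_sub_sq_eq_polar (z w : ℂ) :
    ‖z - w‖ ^ 2 = ‖z‖ ^ 2 + ‖w‖ ^ 2 - 2 * ‖z‖ * ‖w‖ * cos (z.arg - w.arg) := by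
  rw [cos_sub, Complex.sq_norm, Complex.sq_norm, Complex.sq_norm, Complex.normSq_sub,
    show 2 * ‖z‖ * ‖w‖ * (cos z.arg * cos w.arg + sin z.arg * sin w.arg)
      = 2 * ((‖z‖ * cos z.arg) * (‖w‖ * cos w.arg) + (‖z‖ * sin z.arg) * (‖w‖ * sin w.arg)) by ring]
  simp [Complex.norm_mul_cos_arg, Complex.norm_mul_sin_arg]

theorem polar_of_one_lt_norm_sub {z w : ℂ} (h : 1 < ‖z - w‖) :
    2 * ‖z‖ * ‖w‖ * cos (z.arg - w.arg) < ‖z‖ ^ 2 + ‖w‖ ^ 2 - 1 := by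
  have := norm_sub_sq_eq_polar z w
  nlinarith

/-- At most five points of the unit disk have mutual distances larger than one. -/
theorem card_le_five {ι : Type*} (S : Finset ι) (f : ι → ℂ) (hf : ∀ x ∈ S, ‖f x‖ ≤ 1)
    (h : ∀ x ∈ S, ∀ y ∈ S, x ≠ y → 1 < ‖f x - f y‖) : S.card ≤ 5 := by
  refine Nat.le_of_lt_succ (card_lt_of_cos_sub_lt S (fun x => (f x).arg) (by norm_num) ?_)
  intro x hx y hy hne
  have h1 := polar_of_one_lt_norm_sub (h x hx y hy hne)
  have hc : cos (2 * π / (Nat.succ 5 : ℕ)) = 1 / 2 := by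
    rw [← cos_pi_div_three]; congr 1; push_cast; ring
  rw [hc]
  by_contra hge
  push Not at hge
  have hx1 := hf x hx
  have hy1 := hf y hy
  have hx0 := norm_nonneg (f x)
  have hy0 := norm_nonneg (f y)
  -- At an angle of at most 60°, the squared distance is at most `r² + s² - rs ≤ max(r, s)² ≤ 1`.
  have h2 : ‖f x‖ * ‖f y‖ ≤ 2 * ‖f x‖ * ‖f y‖ * cos ((f x).arg - (f y).arg) := by
    nlinarith [mul_nonneg hx0 hy0]
  rcases le_total ‖f x‖ ‖f y‖ with hle | hle <;> nlinarith

theorem cos_two_pi_div_nine_gt : (0.7563 : ℝ) ≤ cos (2 * π / (9 : ℕ)) := by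
  refine le_trans ?_ (one_sub_sq_div_two_le_cos (x := 2 * π / (9 : ℕ)))
  have h1 := pi_lt_d4
  have h2 := pi_pos
  push_cast
  nlinarith

theorem cos_two_pi_div_thirteen_gt : (0.8831 : ℝ) ≤ cos (2 * π / (13 : ℕ)) := by
  refine le_trans ?_ (one_sub_sq_div_two_le_cos (x := 2 * π / (13 : ℕ)))
  have h1 := pi_lt_d4
  have h2 := pi_pos
  push_cast
  nlinarith

/-- At most twenty points with mutual distances larger than one lie in the annulus
`1 < ‖z‖ ≤ 2`. -/
theorem card_le_twenty {ι : Type*} (S : Finset ι) (f : ι → ℂ) (hf1 : ∀ x ∈ S, 1 < ‖f x‖)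
    (hf2 : ∀ x ∈ S, ‖f x‖ ≤ 2) (h : ∀ x ∈ S, ∀ y ∈ S, x ≠ y → 1 < ‖f x - f y‖) :
    S.card ≤ 20 := by
  classical
  -- Split the annulus at radius 1.43 into rings with at most 8 and at most 12 points. For fixed
  -- `γ`, `r² + s² - 2rsγ` is convex in each radius, so it is largest at a corner of the square of
  -- radii. With these cosine bounds it stays below 1 on both squares; the splitting radius has only
  -- a narrow window, about 1.421 to 1.432.
  have hin : (S.filter fun x => ‖f x‖ ≤ 1.43).card < 9 := by
    refine card_lt_of_cos_sub_lt _ (fun x => (f x).arg) (by norm_num) ?_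
    intro x hx y hy hne
    obtain ⟨hx, hxr⟩ := Finset.mem_filter.1 hx
    obtain ⟨hy, hyr⟩ := Finset.mem_filter.1 hy
    refine lt_of_lt_of_le ?_ cos_two_pi_div_nine_gt
    have h1 := polar_of_one_lt_norm_sub (h x hx y hy hne)
    by_contra hge
    push Not at hge
    have hx1 := hf1 x hx
    have hy1 := hf1 y hy
    generalize ‖f x‖ = r at *
    generalize ‖f y‖ = s at *
    generalize cos ((f x).arg - (f y).arg) = γ at *
    have h2 : 2 * (r * s) * 0.7563 ≤ 2 * r * s * γ := by
      have : 0 ≤ r * s := by nlinarith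
      nlinarith
    nlinarith [mul_nonneg (sub_nonneg.2 hx1.le) (sub_nonneg.2 hxr),
      mul_nonneg (sub_nonneg.2 hy1.le) (sub_nonneg.2 hyr),
      mul_nonneg (sub_nonneg.2 hx1.le) (sub_nonneg.2 hyr),
      mul_nonneg (sub_nonneg.2 hy1.le) (sub_nonneg.2 hxr),
      mul_nonneg (sub_nonneg.2 hx1.le) (sub_nonneg.2 hy1.le),
      mul_nonneg (sub_nonneg.2 hxr) (sub_nonneg.2 hyr)]
  have hout : (S.filter fun x => ¬ ‖f x‖ ≤ 1.43).card < 13 := by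
    refine card_lt_of_cos_sub_lt _ (fun x => (f x).arg) (by norm_num) ?_
    intro x hx y hy hne
    obtain ⟨hx, hxr⟩ := Finset.mem_filter.1 hx
    obtain ⟨hy, hyr⟩ := Finset.mem_filter.1 hy
    refine lt_of_lt_of_le ?_ cos_two_pi_div_thirteen_gt
    have h1 := polar_of_one_lt_norm_sub (h x hx y hy hne)
    by_contra hge
    push Not at hge hxr hyr
    have hx1 := hf2 x hx
    have hy1 := hf2 y hy
    generalize ‖f x‖ = r at *
    generalize ‖f y‖ = s at *
    generalize cos ((f x).arg - (f y).arg) = γ at *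
    have h2 : 2 * (r * s) * 0.8831 ≤ 2 * r * s * γ := by
      have : 0 ≤ r * s := by nlinarith
      nlinarith
    nlinarith [mul_nonneg (sub_nonneg.2 hx1) (sub_nonneg.2 hxr.le),
      mul_nonneg (sub_nonneg.2 hy1) (sub_nonneg.2 hyr.le),
      mul_nonneg (sub_nonneg.2 hx1) (sub_nonneg.2 hyr.le),
      mul_nonneg (sub_nonneg.2 hy1) (sub_nonneg.2 hxr.le),
      mul_nonneg (sub_nonneg.2 hx1) (sub_nonneg.2 hy1),
      mul_nonneg (sub_nonneg.2 hxr.le) (sub_nonneg.2 hyr.le)]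
  have := Finset.card_filter_add_card_filter_not (s := S) (fun x => ‖f x‖ ≤ 1.43)
  omega

variable {V : Type*} {G : SimpleGraph V}

theorem IsUnitDiskGraph.exists_complex (hG : IsUnitDiskGraph G) :
    ∃ p : V → ℂ, ∀ u v, G.Adj u v ↔ u ≠ v ∧ ‖p u - p v‖ ≤ 1 := by
  obtain ⟨pos, hpos⟩ := hG
  refine ⟨fun v => Complex.orthonormalBasisOneI.repr.symm (pos v), fun u v => ?_⟩
  rw [hpos, ← map_sub, LinearIsometryEquiv.norm_map, dist_eq_norm]

/-- In a unit disk graph a node has at most five mutually non-adjacent neighbours. -/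
theorem IsUnitDiskGraph.card_le_five (hG : IsUnitDiskGraph G) (u : V) (S : Finset V)
    (hu : ∀ w ∈ S, G.Adj u w) (hS : ∀ v ∈ S, ∀ w ∈ S, v ≠ w → ¬ G.Adj v w) : S.card ≤ 5 := by
  obtain ⟨p, hp⟩ := hG.exists_complex
  refine ETS.card_le_five S (fun w => p w - p u) (fun w hw => ?_) fun v hv w hw hne => ?_
  · exact ((hp w u).1 (hu w hw).symm).2
  · rw [sub_sub_sub_cancel_right]
    exact not_le.1 fun hle => hS v hv w hw hne ((hp v w).2 ⟨hne, hle⟩)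

/-- In a unit disk graph there are at most twenty mutually non-adjacent nodes at hop distance two
from a given node. -/
theorem IsUnitDiskGraph.card_le_twenty (hG : IsUnitDiskGraph G) (u : V) (S : Finset V)
    (hne : ∀ w ∈ S, w ≠ u) (hadj : ∀ w ∈ S, ¬ G.Adj w u)
    (hu : ∀ w ∈ S, ∃ x, G.Adj w x ∧ G.Adj x u)
    (hS : ∀ v ∈ S, ∀ w ∈ S, v ≠ w → ¬ G.Adj v w) : S.card ≤ 20 := by
  obtain ⟨p, hp⟩ := hG.exists_complex
  refine ETS.card_le_twenty S (fun w => p w - p u) (fun w hw => ?_) (fun w hw => ?_)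
    fun v hv w hw hvw => ?_
  · exact not_le.1 fun hle => hadj w hw ((hp w u).2 ⟨hne w hw, hle⟩)
  · obtain ⟨x, h1, h2⟩ := hu w hw
    have h3 := norm_sub_le_norm_sub_add_norm_sub (p w) (p x) (p u)
    linarith [((hp w x).1 h1).2, ((hp x u).1 h2).2]
  · rw [sub_sub_sub_cancel_right]
    exact not_le.1 fun hle => hS v hv w hw hvw ((hp v w).2 ⟨hvw, hle⟩)

end Geometry

end ETS

namespace ETS

/-! ### Layers of the breadth-first structure. -/

section Distance

variable {V : Type*} {G : SimpleGraph V} {s : V}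

theorem dist_le_dist_add_one (hconn : G.Connected) {u v : V} (h : G.Adj u v) :
    G.dist s v ≤ G.dist s u + 1 := by
  have h1 := hconn.dist_triangle (u := s) (v := u) (w := v)
  rwa [SimpleGraph.dist_eq_one_iff_adj.2 h] at h1

theorem exists_adj_of_dist_eq_succ (hconn : G.Connected) {v : V} {n : ℕ}
    (h : G.dist s v = n + 1) : ∃ u, G.Adj u v ∧ G.dist s u = n := by
  obtain ⟨p, hp⟩ := hconn.exists_walk_length_eq_dist v s
  rw [SimpleGraph.dist_comm, h] at hp
  cases p with
  | nil => simp at hp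
  | @cons _ u _ huv q =>
    refine ⟨u, huv.symm, ?_⟩
    have h1 := SimpleGraph.dist_le q
    rw [SimpleGraph.dist_comm] at h1
    have h2 := dist_le_dist_add_one (s := s) hconn huv.symm
    simp only [SimpleGraph.Walk.length_cons] at hp
    omega

theorem exists_dist_eq_succ (hconn : G.Connected) {v : V} (hv : v ≠ s) :
    ∃ i, G.dist s v = i + 1 :=
  Nat.exists_eq_succ_of_ne_zero (hconn.pos_dist_of_ne hv.symm).ne'

end Distance

/-! ### Structure of the greedily chosen dominators and connectors. -/

section Greedy

open scoped Classical

variable {V : Type*} {k : ℕ} {G : SimpleGraph V} {τ : TieBreak V} {c : Fin k}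

theorem mem_nbrsIn {u v : V} {U : Finset V} : v ∈ nbrsIn G u U ↔ v ∈ U ∧ G.Adj u v :=
  Finset.mem_filter

theorem dominate_induction {P : Finset V → List (Tx V k) → Prop} (nil : P ∅ [])
    (cons : ∀ U u l, u ∈ U → P (U \ insert u (nbrsIn G u U)) l →
      P U (⟨u, c, nbrsIn G u U⟩ :: l)) (U : Finset V) : P U (dominate G τ c U) := by
  induction U using Finset.strongInduction with
  | H U ih =>
    rw [dominate]
    split_ifs with h
    · have hu := argmaxSet_subset _ _
        (τ.pick_mem U _ (argmaxSet_nonempty (fun v => (nbrsIn G v U).card) h))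
      refine cons _ _ _ hu (ih _ (Finset.ssubset_iff_subset_ne.2
        ⟨Finset.sdiff_subset, fun he => ?_⟩))
      exact (Finset.mem_sdiff.1 (he.ge hu)).2 (Finset.mem_insert_self _ _)
    · rwa [Finset.not_nonempty_iff_eq_empty.1 h]

/-- All that is kept of the greedy maximality is that a chosen connector has at least one new child.
-/
theorem connect_induction {R : Finset V} {P : Finset V → List (Tx V k) → Prop}
    (nil : ∀ U, (∀ v ∈ R, nbrsIn G v U = ∅) → P U [])
    (cons : ∀ U u l, u ∈ R → (nbrsIn G u U).Nonempty → P (U \ nbrsIn G u U) l →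
      P U (⟨u, c, nbrsIn G u U⟩ :: l)) (U : Finset V) : P U (connect G τ c R U) := by
  induction U using Finset.strongInduction with
  | H U ih =>
    rw [connect]
    split_ifs with h
    · obtain ⟨v, hv, hne⟩ := h
      have hm := τ.pick_mem U _ (argmaxSet_nonempty (fun v => (nbrsIn G v U).card) ⟨v, hv⟩)
      have hne' : (nbrsIn G (τ.pick U (argmaxSet R fun v => (nbrsIn G v U).card)) U).Nonempty :=
        Finset.card_pos.1 ((Finset.card_pos.2 hne).trans_le ((Finset.mem_filter.1 hm).2 v hv))
      refine cons _ _ _ (argmaxSet_subset _ _ hm) hne'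
        (ih _ (Finset.ssubset_iff_subset_ne.2 ⟨Finset.sdiff_subset, fun he => ?_⟩))
      obtain ⟨w, hw⟩ := hne'
      have h1 := (mem_nbrsIn.1 hw).1
      rw [← he] at h1
      exact (Finset.mem_sdiff.1 h1).2 hw
    · push Not at h
      exact nil _ fun v hv => Finset.not_nonempty_iff_eq_empty.1 (by simpa using h v hv)

/-- The relation between an earlier and a later dominator of the same layer and channel. -/
structure DomRel (G : SimpleGraph V) (J' J : Tx V k) : Prop where
  ne : J'.node ≠ J.node
  not_adj : ¬ G.Adj J'.node J.node
  disjoint : Disjoint J'.targets J.targets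

/-- The relation between an earlier and a later connector for the same layer and channel. -/
structure ConnRel (G : SimpleGraph V) (J' J : Tx V k) : Prop where
  ne : J'.node ≠ J.node
  not_adj : ∀ v ∈ J.targets, ¬ G.Adj J'.node v
  disjoint : Disjoint J'.targets J.targets

/-- The properties of the list of dominators of a set `U`. -/
structure DomSpec (G : SimpleGraph V) (c : Fin k) (U : Finset V) (l : List (Tx V k)) : Prop where
  node_mem : ∀ J ∈ l, J.node ∈ U
  chan_eq : ∀ J ∈ l, J.chan = c
  targets_subset : ∀ J ∈ l, J.targets ⊆ U
  adj : ∀ J ∈ l, ∀ v ∈ J.targets, G.Adj J.node v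
  rel : l.Pairwise (DomRel G)
  node_notMem : ∀ J ∈ l, ∀ J' ∈ l, J.node ∉ J'.targets
  cover : ∀ v ∈ U, ∃ J ∈ l, J.node = v ∨ v ∈ J.targets

/-- The properties of the list of connectors from `R` for a set `U`. -/
structure ConnSpec (G : SimpleGraph V) (c : Fin k) (R U : Finset V) (l : List (Tx V k)) :
    Prop where
  node_mem : ∀ J ∈ l, J.node ∈ R
  chan_eq : ∀ J ∈ l, J.chan = c
  targets_subset : ∀ J ∈ l, J.targets ⊆ U
  nonempty : ∀ J ∈ l, J.targets.Nonempty
  adj : ∀ J ∈ l, ∀ v ∈ J.targets, G.Adj J.node v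
  rel : l.Pairwise (ConnRel G)
  cover : (∀ v ∈ U, ∃ r ∈ R, G.Adj r v) → ∀ v ∈ U, ∃ J ∈ l, v ∈ J.targets

/-- A chosen `u` leaves `U` together with all its neighbours there, so whatever is chosen or served
later is neither `u` nor adjacent to it. -/
theorem domSpec_dominate (U : Finset V) : DomSpec G c U (dominate G τ c U) := by
  refine dominate_induction (P := DomSpec G c) ?_ (fun U u l hu ih => ?_) U
  · constructor <;> simp
  · have hsub : ∀ v, v ∈ U \ insert u (nbrsIn G u U) → v ∈ U ∧ v ≠ u ∧ ¬ G.Adj u v := by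
      intro v hv
      simp only [Finset.mem_sdiff, Finset.mem_insert, mem_nbrsIn, not_or, not_and] at hv
      exact ⟨hv.1, hv.2.1, hv.2.2 hv.1⟩
    refine ⟨?_, ?_, ?_, ?_, ?_, ?_, ?_⟩
    · rintro J (_ | ⟨_, hJ⟩)
      exacts [hu, (hsub _ (ih.node_mem J hJ)).1]
    · rintro J (_ | ⟨_, hJ⟩)
      exacts [rfl, ih.chan_eq J hJ]
    · rintro J (_ | ⟨_, hJ⟩) v hv
      exacts [(mem_nbrsIn.1 hv).1, (hsub _ (ih.targets_subset J hJ hv)).1]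
    · rintro J (_ | ⟨_, hJ⟩) v hv
      exacts [(mem_nbrsIn.1 hv).2, ih.adj J hJ v hv]
    · refine List.pairwise_cons.2 ⟨fun J hJ => ?_, ih.rel⟩
      have h1 := hsub _ (ih.node_mem J hJ)
      refine ⟨h1.2.1.symm, h1.2.2, Finset.disjoint_left.2 fun v hv hv' => ?_⟩
      exact (hsub _ (ih.targets_subset J hJ hv')).2.2 (mem_nbrsIn.1 hv).2
    · rintro J (_ | ⟨_, hJ⟩) J' (_ | ⟨_, hJ'⟩) hm
      · exact G.loopless.irrefl _ (mem_nbrsIn.1 hm).2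
      · exact (hsub _ (ih.targets_subset J' hJ' hm)).2.1 rfl
      · exact (hsub _ (ih.node_mem J hJ)).2.2 (mem_nbrsIn.1 hm).2
      · exact ih.node_notMem J hJ J' hJ' hm
    · intro v hv
      by_cases h : v ∈ U \ insert u (nbrsIn G u U)
      · obtain ⟨J, hJ, h1⟩ := ih.cover v h
        exact ⟨J, List.mem_cons_of_mem _ hJ, h1⟩
      · refine ⟨_, List.mem_cons_self, ?_⟩
        simp only [Finset.mem_sdiff, hv, true_and, not_not, Finset.mem_insert] at h
        exact h.imp Eq.symm id

/-- A connector takes all its neighbours still in `U`, so it is not heard by the children of later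
connectors. As those have children, no connector is chosen twice. -/
theorem connSpec_connect (R U : Finset V) : ConnSpec G c R U (connect G τ c R U) := by
  refine connect_induction (P := ConnSpec G c R) (fun U hU => ?_) (fun U u l hu hne ih => ?_) U
  · constructor
    case cover =>
      intro h v hv
      obtain ⟨r, hr, hrv⟩ := h v hv
      have : v ∈ nbrsIn G r U := mem_nbrsIn.2 ⟨hv, hrv⟩
      simp [hU r hr] at this
    all_goals simp
  · have hsub : ∀ v, v ∈ U \ nbrsIn G u U → v ∈ U ∧ ¬ G.Adj u v := by
      intro v hv
      simp only [Finset.mem_sdiff, mem_nbrsIn, not_and] at hv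
      exact ⟨hv.1, hv.2 hv.1⟩
    refine ⟨?_, ?_, ?_, ?_, ?_, ?_, ?_⟩
    · rintro J (_ | ⟨_, hJ⟩)
      exacts [hu, ih.node_mem J hJ]
    · rintro J (_ | ⟨_, hJ⟩)
      exacts [rfl, ih.chan_eq J hJ]
    · rintro J (_ | ⟨_, hJ⟩) v hv
      exacts [(mem_nbrsIn.1 hv).1, (hsub _ (ih.targets_subset J hJ hv)).1]
    · rintro J (_ | ⟨_, hJ⟩)
      exacts [hne, ih.nonempty J hJ]
    · rintro J (_ | ⟨_, hJ⟩) v hv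
      exacts [(mem_nbrsIn.1 hv).2, ih.adj J hJ v hv]
    · refine List.pairwise_cons.2 ⟨fun J hJ => ?_, ih.rel⟩
      have h1 : ∀ v ∈ J.targets, ¬ G.Adj u v :=
        fun v hv => (hsub _ (ih.targets_subset J hJ hv)).2
      refine ⟨?_, h1, Finset.disjoint_left.2 fun v hv hv' => h1 v hv' (mem_nbrsIn.1 hv).2⟩
      rintro rfl
      obtain ⟨v, hv⟩ := ih.nonempty J hJ
      exact h1 v hv (ih.adj J hJ v hv)
    · intro hR v hv
      by_cases h : v ∈ U \ nbrsIn G u U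
      · obtain ⟨J, hJ, h1⟩ := ih.cover (fun w hw => hR w (hsub w hw).1) v h
        exact ⟨J, List.mem_cons_of_mem _ hJ, h1⟩
      · refine ⟨_, List.mem_cons_self, ?_⟩
        simpa only [Finset.mem_sdiff, hv, true_and, not_not] using h

end Greedy

/-! ### The order of the plan, and who is served before whom. -/

section Plan

open scoped Classical

variable {V : Type*} [Fintype V] {k : ℕ} {G : SimpleGraph V} {A : V → Fin k} {s : V}
  {τ : TieBreak V}

theorem mem_layer {i : ℕ} {v : V} : v ∈ layer G s i ↔ G.dist s v = i := by
  simp [layer]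

theorem mem_layerCh {i : ℕ} {c : Fin k} {v : V} :
    v ∈ layerCh G A s i c ↔ G.dist s v = i ∧ A v = c := by
  simp [layerCh, mem_layer]

theorem domSpec_dominators (i : ℕ) (c : Fin k) :
    DomSpec G c (layerCh G A s i c) (dominators G A s τ i c) :=
  domSpec_dominate _

theorem connSpec_connectors (i : ℕ) (c : Fin k) :
    ConnSpec G c (layer G s i) ((dominators G A s τ (i + 1) c).map Tx.node).toFinset
      (connectors G A s τ i c) :=
  connSpec_connect _ _

variable {J J' : Tx V k} {i j : ℕ} {c d : Fin k}

theorem dist_node_of_mem_dominators (hJ : J ∈ dominators G A s τ i c) : G.dist s J.node = i :=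
  (mem_layerCh.1 ((domSpec_dominators i c).node_mem J hJ)).1

theorem chan_node_of_mem_dominators (hJ : J ∈ dominators G A s τ i c) : A J.node = c :=
  (mem_layerCh.1 ((domSpec_dominators i c).node_mem J hJ)).2

theorem dist_target_of_mem_dominators (hJ : J ∈ dominators G A s τ i c) {v : V}
    (hv : v ∈ J.targets) : G.dist s v = i :=
  (mem_layerCh.1 ((domSpec_dominators i c).targets_subset J hJ hv)).1

theorem chan_target_of_mem_dominators (hJ : J ∈ dominators G A s τ i c) {v : V}
    (hv : v ∈ J.targets) : A v = c :=
  (mem_layerCh.1 ((domSpec_dominators i c).targets_subset J hJ hv)).2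

theorem dist_node_of_mem_connectors (hJ : J ∈ connectors G A s τ i c) : G.dist s J.node = i :=
  mem_layer.1 ((connSpec_connectors i c).node_mem J hJ)

theorem target_of_mem_connectors (hJ : J ∈ connectors G A s τ i c) {v : V} (hv : v ∈ J.targets) :
    ∃ J' ∈ dominators G A s τ (i + 1) c, J'.node = v := by
  simpa using (connSpec_connectors i c).targets_subset J hJ hv

theorem dist_target_of_mem_connectors (hJ : J ∈ connectors G A s τ i c) {v : V}
    (hv : v ∈ J.targets) : G.dist s v = i + 1 := by
  obtain ⟨J', hJ', rfl⟩ := target_of_mem_connectors hJ hv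
  exact dist_node_of_mem_dominators hJ'

theorem chan_target_of_mem_connectors (hJ : J ∈ connectors G A s τ i c) {v : V}
    (hv : v ∈ J.targets) : A v = c := by
  obtain ⟨J', hJ', rfl⟩ := target_of_mem_connectors hJ hv
  exact chan_node_of_mem_dominators hJ'

theorem not_adj_of_mem_dominators (hJ : J ∈ dominators G A s τ i c)
    (hJ' : J' ∈ dominators G A s τ i c) : ¬ G.Adj J.node J'.node := by
  by_cases h : J = J'
  · rw [h]; exact G.loopless.irrefl _
  · have : Std.Symm fun J J' : Tx V k => ¬ G.Adj J.node J'.node :=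
      ⟨fun a b hab hba => hab hba.symm⟩
    exact List.Pairwise.forall (((domSpec_dominators i c).rel).imp DomRel.not_adj) hJ hJ' h

/-- `J` is planned in the round of layer `i + 1` and channel `c`. -/
def InBlock (G : SimpleGraph V) (A : V → Fin k) (s : V) (τ : TieBreak V) (i : ℕ) (c : Fin k)
    (J : Tx V k) : Prop :=
  J ∈ connectors G A s τ i c ∨ J ∈ dominators G A s τ (i + 1) c

theorem InBlock.chan_eq (h : InBlock G A s τ i c J) : J.chan = c :=
  h.elim ((connSpec_connectors i c).chan_eq J) ((domSpec_dominators (i + 1) c).chan_eq J)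

theorem InBlock.dist_target (h : InBlock G A s τ i c J) {v : V} (hv : v ∈ J.targets) :
    G.dist s v = i + 1 :=
  h.elim (fun h => dist_target_of_mem_connectors h hv) fun h => dist_target_of_mem_dominators h hv

theorem InBlock.chan_target (h : InBlock G A s τ i c J) {v : V} (hv : v ∈ J.targets) :
    A v = c :=
  h.elim (fun h => chan_target_of_mem_connectors h hv) fun h => chan_target_of_mem_dominators h hv

theorem InBlock.adj (h : InBlock G A s τ i c J) {v : V} (hv : v ∈ J.targets) :
    G.Adj J.node v :=
  h.elim (fun h => (connSpec_connectors i c).adj J h v hv)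
    fun h => (domSpec_dominators (i + 1) c).adj J h v hv

theorem InBlock.dist_node_le (h : InBlock G A s τ i c J) : G.dist s J.node ≤ i + 1 :=
  h.elim (fun h => (dist_node_of_mem_connectors h).trans_le (Nat.le_succ i))
    fun h => (dist_node_of_mem_dominators h).le

/-- A connector has a child, and it lies one layer further out, whereas children of a dominator lie
in its own layer. -/
theorem not_mem_dominators_of_mem_connectors (h : J ∈ connectors G A s τ i c) :
    J ∉ dominators G A s τ j d := fun h' => by
  obtain ⟨v, hv⟩ := (connSpec_connectors i c).nonempty J h
  have h1 := dist_node_of_mem_connectors h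
  have h2 := dist_target_of_mem_connectors h hv
  have h3 := dist_node_of_mem_dominators h'
  have h4 := dist_target_of_mem_dominators h' hv
  omega

theorem InBlock.unique (h : InBlock G A s τ i c J) (h' : InBlock G A s τ j d J) :
    i = j ∧ c = d := by
  refine ⟨?_, h.chan_eq.symm.trans h'.chan_eq⟩
  rcases h with h | h <;> rcases h' with h' | h'
  · exact (dist_node_of_mem_connectors h).symm.trans (dist_node_of_mem_connectors h')
  · exact absurd h' (not_mem_dominators_of_mem_connectors h)
  · exact absurd h (not_mem_dominators_of_mem_connectors h')
  · exact Nat.succ_injective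
      ((dist_node_of_mem_dominators h).symm.trans (dist_node_of_mem_dominators h'))

theorem mem_plan : J ∈ plan G A s τ ↔ ∃ i < depth G s, ∃ c, InBlock G A s τ i c J := by
  simp [plan, InBlock]

theorem dist_le_depth (v : V) : G.dist s v ≤ depth G s :=
  Finset.le_sup (f := fun v => G.dist s v) (Finset.mem_univ v)

/-- `J'` is planned before `J`. -/
inductive Before (G : SimpleGraph V) (A : V → Fin k) (s : V) (τ : TieBreak V) (J' J : Tx V k) :
    Prop
  | layer {i j : ℕ} {c d : Fin k} (hij : i < j) (h' : InBlock G A s τ i c J')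
      (h : InBlock G A s τ j d J)
  | chan {i : ℕ} {c d : Fin k} (hcd : c ≠ d) (h' : InBlock G A s τ i c J')
      (h : InBlock G A s τ i d J)
  | kind {i : ℕ} {c : Fin k} (h' : J' ∈ connectors G A s τ i c)
      (h : J ∈ dominators G A s τ (i + 1) c)
  | conn {i : ℕ} {c : Fin k} (h' : J' ∈ connectors G A s τ i c)
      (h : J ∈ connectors G A s τ i c) (hr : ConnRel G J' J)
  | dom {i : ℕ} {c : Fin k} (h' : J' ∈ dominators G A s τ (i + 1) c)
      (h : J ∈ dominators G A s τ (i + 1) c) (hr : DomRel G J' J)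

theorem pairwise_before_plan : (plan G A s τ).Pairwise (Before G A s τ) := by
  rw [plan, List.pairwise_flatMap]
  refine ⟨fun i _ => ?_, List.pairwise_lt_range.imp fun hij J' h' J h => ?_⟩
  · rw [List.pairwise_flatMap]
    refine ⟨fun c _ => ?_, (List.pairwise_lt_finRange k).imp fun hcd J' h' J h => ?_⟩
    · rw [List.pairwise_append]
      refine ⟨?_, ?_, fun J' h' J h => .kind h' h⟩
      · exact (connSpec_connectors i c).rel.imp_of_mem fun h' h hr => .conn h' h hr
      · exact (domSpec_dominators (i + 1) c).rel.imp_of_mem fun h' h hr => .dom h' h hr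
    · exact .chan hcd.ne (List.mem_append.1 h') (List.mem_append.1 h)
  · simp only [List.mem_flatMap, List.mem_append] at h' h
    obtain ⟨c, _, h'⟩ := h'
    obtain ⟨d, _, h⟩ := h
    exact .layer hij h' h

theorem Before.disjoint (h : Before G A s τ J' J) : Disjoint J'.targets J.targets := by
  rw [Finset.disjoint_left]
  intro v hv' hv
  cases h with
  | layer hij h' h =>
    have h1 := h'.dist_target hv'
    have h2 := h.dist_target hv
    omega
  | chan hcd h' h => exact hcd ((h'.chan_target hv').symm.trans (h.chan_target hv))
  | kind h' h =>
    obtain ⟨J₁, hJ₁, rfl⟩ := target_of_mem_connectors h' hv'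
    exact (domSpec_dominators _ _).node_notMem _ hJ₁ _ h hv
  | conn h' h hr => exact Finset.disjoint_left.1 hr.disjoint hv' hv
  | dom h' h hr => exact Finset.disjoint_left.1 hr.disjoint hv' hv

/-- What can be planned before a dominator. -/
theorem Before.of_mem_dominators (hJ : J ∈ dominators G A s τ (i + 1) c)
    (h : Before G A s τ J' J) :
    G.dist s J'.node ≤ i ∨ (∃ d ≠ c, J' ∈ dominators G A s τ (i + 1) d) ∨
      (J' ∈ dominators G A s τ (i + 1) c ∧ DomRel G J' J) := by
  cases h with
  | @layer i₁ j₁ _ _ hij h' h =>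
    obtain ⟨rfl, rfl⟩ := h.unique (.inr hJ)
    exact .inl (h'.dist_node_le.trans hij)
  | @chan i₁ c₁ _ hcd h' h =>
    obtain ⟨rfl, rfl⟩ := h.unique (.inr hJ)
    rcases h' with h' | h'
    exacts [.inl (dist_node_of_mem_connectors h').le, .inr (.inl ⟨_, hcd, h'⟩)]
  | kind h' h =>
    obtain ⟨rfl, rfl⟩ := InBlock.unique (.inr h) (.inr hJ)
    exact .inl (dist_node_of_mem_connectors h').le
  | conn h' h hr => exact absurd hJ (not_mem_dominators_of_mem_connectors h)
  | dom h' h hr =>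
    obtain ⟨rfl, rfl⟩ := InBlock.unique (.inr h) (.inr hJ)
    exact .inr (.inr ⟨h', hr⟩)

/-- What can be planned before a connector. -/
theorem Before.of_mem_connectors (hJ : J ∈ connectors G A s τ i c)
    (h : Before G A s τ J' J) :
    (∃ j < i, ∃ d, InBlock G A s τ j d J') ∨ (∃ d ≠ c, J' ∈ connectors G A s τ i d) ∨
      (J' ∈ connectors G A s τ i c ∧ ConnRel G J' J) ∨
      (∃ d ≠ c, J' ∈ dominators G A s τ (i + 1) d) := by
  cases h with
  | layer hij h' h =>
    obtain ⟨rfl, rfl⟩ := h.unique (.inl hJ)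
    exact .inl ⟨_, hij, _, h'⟩
  | chan hcd h' h =>
    obtain ⟨rfl, rfl⟩ := h.unique (.inl hJ)
    rcases h' with h' | h'
    exacts [.inr (.inl ⟨_, hcd, h'⟩), .inr (.inr (.inr ⟨_, hcd, h'⟩))]
  | kind h' h => exact absurd h (not_mem_dominators_of_mem_connectors hJ)
  | conn h' h hr =>
    obtain ⟨rfl, rfl⟩ := InBlock.unique (.inl h) (.inl hJ)
    exact .inr (.inr (.inl ⟨h', hr⟩))
  | dom h' h hr => exact absurd h (not_mem_dominators_of_mem_connectors hJ)

theorem Before.le (h : Before G A s τ J' J) (hJ' : InBlock G A s τ i c J')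
    (hJ : InBlock G A s τ j d J) : i ≤ j := by
  cases h with
  | layer hij h' h => rw [(hJ'.unique h').1, (hJ.unique h).1]; exact hij.le
  | chan _ h' h => rw [(hJ'.unique h').1, (hJ.unique h).1]
  | kind h' h => rw [(hJ'.unique (.inl h')).1, (hJ.unique (.inr h)).1]
  | conn h' h => rw [(hJ'.unique (.inl h')).1, (hJ.unique (.inl h)).1]
  | dom h' h => rw [(hJ'.unique (.inr h')).1, (hJ.unique (.inr h)).1]

/-- Every dominator is covered by a connector of the previous layer. -/
theorem exists_connector (hconn : G.Connected) (hJ : J ∈ dominators G A s τ (i + 1) c) :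
    ∃ J' ∈ connectors G A s τ i c, J.node ∈ J'.targets := by
  refine (connSpec_connectors i c).cover (fun v hv => ?_) J.node (by simpa using ⟨J, hJ, rfl⟩)
  obtain ⟨J₁, hJ₁, rfl⟩ : ∃ J' ∈ dominators G A s τ (i + 1) c, J'.node = v := by simpa using hv
  obtain ⟨u, hu, hd⟩ := exists_adj_of_dist_eq_succ hconn (dist_node_of_mem_dominators hJ₁)
  exact ⟨u, mem_layer.2 hd, hu⟩

theorem exists_inBlock_target (hconn : G.Connected) {v : V} (hv : G.dist s v = i + 1) :
    ∃ J, InBlock G A s τ i (A v) J ∧ v ∈ J.targets := by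
  obtain ⟨J, hJ, rfl | h⟩ :=
    (domSpec_dominators (τ := τ) (i + 1) (A v)).cover v (mem_layerCh.2 ⟨hv, rfl⟩)
  · obtain ⟨J', hJ', h⟩ := exists_connector hconn hJ
    exact ⟨J', .inl hJ', h⟩
  · exact ⟨J, .inr hJ, h⟩

theorem InBlock.mem_plan_of_mem_targets (h : InBlock G A s τ i c J) {v : V}
    (hv : v ∈ J.targets) : J ∈ plan G A s τ :=
  mem_plan.2 ⟨i, by have := h.dist_target hv; have := dist_le_depth (G := G) (s := s) v; omega,
    c, h⟩

theorem exists_mem_plan_target (hconn : G.Connected) {v : V} (hv : v ≠ s) :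
    ∃ J ∈ plan G A s τ, v ∈ J.targets := by
  obtain ⟨i, hi⟩ := exists_dist_eq_succ hconn hv
  obtain ⟨J, hJ, h⟩ := exists_inBlock_target (A := A) (τ := τ) hconn hi
  exact ⟨J, hJ.mem_plan_of_mem_targets h, h⟩

theorem source_notMem_targets (hJ : J ∈ plan G A s τ) : s ∉ J.targets := fun h => by
  obtain ⟨i, _, c, hJ⟩ := mem_plan.1 hJ
  have := hJ.dist_target h
  simp at this

theorem adj_of_mem_plan (hJ : J ∈ plan G A s τ) {v : V} (hv : v ∈ J.targets) :
    G.Adj J.node v := by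
  obtain ⟨i, _, c, hJ⟩ := mem_plan.1 hJ
  exact hJ.adj hv

theorem chan_of_mem_plan (hJ : J ∈ plan G A s τ) {v : V} (hv : v ∈ J.targets) :
    A v = J.chan := by
  obtain ⟨i, _, c, hJ⟩ := mem_plan.1 hJ
  exact (hJ.chan_target hv).trans hJ.chan_eq.symm

/-- A planned transmitter other than the source is served earlier in the plan. -/
theorem exists_earlier_target (hconn : G.Connected) {pre post : List (Tx V k)}
    (hp : plan G A s τ = pre ++ J :: post) :
    J.node = s ∨ ∃ J' ∈ pre, J.node ∈ J'.targets := by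
  have hJ : J ∈ plan G A s τ := by simp [hp]
  have hpw := pairwise_before_plan (G := G) (A := A) (s := s) (τ := τ)
  rw [hp, List.pairwise_append, List.pairwise_cons] at hpw
  obtain ⟨i, hi, c, hJb⟩ := mem_plan.1 hJ
  -- It suffices to find a server of `J.node` other than `J` that `J` does not precede: since the
  -- plan is ordered by `Before`, it must then lie in `pre`. Connectors are served in the previous
  -- round, dominators by connectors of their own round.
  obtain ⟨J', hne, hJ', hJ't, hno⟩ | h : (∃ J' ≠ J, J' ∈ plan G A s τ ∧ J.node ∈ J'.targets ∧
      ¬ Before G A s τ J J') ∨ J.node = s := by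
    rcases hJb with hJc | hJd
    · cases i with
      | zero => exact .inr ((hconn.dist_eq_zero_iff.1 (dist_node_of_mem_connectors hJc)).symm)
      | succ i =>
        obtain ⟨J', hJ', h⟩ := exists_inBlock_target (A := A) (τ := τ) hconn
          (dist_node_of_mem_connectors hJc)
        refine .inl ⟨J', ?_, hJ'.mem_plan_of_mem_targets h, h, fun hb => ?_⟩
        · rintro rfl
          have := (hJ'.unique (.inl hJc)).1
          omega
        · have := hb.le (.inl hJc) hJ'
          omega
    · obtain ⟨J', hJ', h⟩ := exists_connector hconn hJd
      refine .inl ⟨J', ?_, InBlock.mem_plan_of_mem_targets (.inl hJ') h, h, fun hb => ?_⟩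
      · rintro rfl
        exact not_mem_dominators_of_mem_connectors hJ' hJd
      · have h1 := dist_node_of_mem_dominators hJd
        rcases hb.of_mem_connectors hJ' with ⟨j, hj, d, h'⟩ | ⟨d, _, h'⟩ | ⟨h', -⟩ | ⟨d, hd, h'⟩
        · have := h'.dist_node_le
          omega
        · exact not_mem_dominators_of_mem_connectors h' hJd
        · exact not_mem_dominators_of_mem_connectors h' hJd
        · exact hd ((InBlock.unique (.inr h') (.inr hJd)).2)
  · right
    rw [hp, List.mem_append, List.mem_cons] at hJ'
    rcases hJ' with h | h | h
    exacts [⟨J', h, hJ't⟩, absurd h hne, absurd (hpw.2.1.1 J' h) hno]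
  · exact .inl h

end Plan

end ETS

namespace ETS

/-! ### The depth bounds every broadcast schedule from below. -/

section LowerBound

/-- In any broadcast schedule the message advances by at most one layer per slot. -/
theorem InformedBefore.dist_le {V : Type*} {k : ℕ} {G : SimpleGraph V} {A : V → Fin k}
    {s v : V} {S : Schedule V k} {T t : ℕ} (hconn : G.Connected)
    (hS : IsBroadcastSchedule G A s S T) (h : InformedBefore G A s S t v) :
    G.dist s v ≤ t - 1 := by
  induction t using Nat.strong_induction_on generalizing v with
  | _ t ih =>
    rcases h with rfl | ⟨r, hr, u, huv⟩
    · simp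
    · have h1 := ih r hr (hS.causal r u _ huv.2.1)
      -- Slots start at 1, so the truncated `r - 1` satisfies `r - 1 + 1 = r ≤ t - 1`.
      have h2 := (hS.slots r _ huv.2.1).1
      have h3 := dist_le_dist_add_one (s := s) hconn huv.1
      omega

end LowerBound

/-! ### Invariants of the scheduler on an arbitrary list. -/

section Scheduler

open scoped Classical

variable {V : Type*} {k : ℕ} {G : SimpleGraph V} {A : V → Fin k} {s : V}

/-- The state of the scheduler after processing the list `l`. -/
noncomputable def run (G : SimpleGraph V) (A : V → Fin k) (s : V) (l : List (Tx V k)) :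
    State V k :=
  l.foldl (step G A) (init k s)

variable {l : List (Tx V k)} {e e' : Tx V k × ℕ}

theorem run_append_singleton (l : List (Tx V k)) (J : Tx V k) :
    run G A s (l ++ [J]) = step G A (run G A s l) J := by
  simp [run]

theorem log_run_append_singleton (l : List (Tx V k)) (J : Tx V k) :
    (run G A s (l ++ [J])).log
      = (run G A s l).log ++ [(J, earliestSlot G A (run G A s l) J)] := by
  rw [run_append_singleton]; rfl

theorem map_fst_log_run (l : List (Tx V k)) : (run G A s l).log.map Prod.fst = l := by
  induction l using List.reverseRecOn with
  | nil => rfl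
  | append_singleton l J ih => rw [log_run_append_singleton, List.map_append, ih]; rfl

theorem fst_mem_of_mem_log (he : e ∈ (run G A s l).log) : e.1 ∈ l := by
  have h := List.mem_map_of_mem (f := Prod.fst) he
  rwa [map_fst_log_run] at h

theorem exists_mem_log {J : Tx V k} (hJ : J ∈ l) : ∃ t, (J, t) ∈ (run G A s l).log := by
  rw [← map_fst_log_run (G := G) (A := A) (s := s) l] at hJ
  obtain ⟨⟨_, t⟩, h, rfl⟩ := List.mem_map.1 hJ
  exact ⟨t, h⟩

theorem log_run_subset (l l' : List (Tx V k)) :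
    (run G A s l).log ⊆ (run G A s (l ++ l')).log := by
  induction l' using List.reverseRecOn with
  | nil => simp
  | append_singleton l' J ih =>
    rw [← List.append_assoc, log_run_append_singleton]
    exact List.Subset.trans ih (List.subset_append_left _ _)

/-- In the processing of `l`, the entry `e` was added directly after the list `pre`. -/
def PlacedAfter (G : SimpleGraph V) (A : V → Fin k) (s : V) (l : List (Tx V k))
    (e : Tx V k × ℕ) (pre : List (Tx V k)) : Prop :=
  (∃ post, l = pre ++ e.1 :: post) ∧ e.2 = earliestSlot G A (run G A s pre) e.1

theorem PlacedAfter.append {pre : List (Tx V k)} (h : PlacedAfter G A s l e pre)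
    (l' : List (Tx V k)) : PlacedAfter G A s (l ++ l') e pre := by
  obtain ⟨⟨post, rfl⟩, h⟩ := h
  exact ⟨⟨post ++ l', by simp⟩, h⟩

theorem PlacedAfter.log_subset {pre : List (Tx V k)} (h : PlacedAfter G A s l e pre) :
    (run G A s pre).log ⊆ (run G A s l).log := by
  obtain ⟨⟨post, rfl⟩, -⟩ := h
  exact log_run_subset _ _

theorem exists_placedAfter (he : e ∈ (run G A s l).log) : ∃ pre, PlacedAfter G A s l e pre := by
  induction l using List.reverseRecOn with
  | nil => simp [run, init] at he
  | append_singleton l J ih =>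
    rw [log_run_append_singleton, List.mem_append, List.mem_singleton] at he
    rcases he with he | rfl
    · obtain ⟨pre, h⟩ := ih he
      exact ⟨pre, h.append _⟩
    · exact ⟨l, ⟨[], rfl⟩, rfl⟩

/-- Of two different entries, one was added when the other was already present. -/
theorem eq_or_placedAfter (he : e ∈ (run G A s l).log) (he' : e' ∈ (run G A s l).log) :
    e = e' ∨ (∃ pre, PlacedAfter G A s l e pre ∧ e' ∈ (run G A s pre).log) ∨
      ∃ pre, PlacedAfter G A s l e' pre ∧ e ∈ (run G A s pre).log := by
  induction l using List.reverseRecOn with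
  | nil => simp [run, init] at he
  | append_singleton l J ih =>
    rw [log_run_append_singleton, List.mem_append, List.mem_singleton] at he he'
    rcases he with he | rfl <;> rcases he' with he' | rfl
    · rcases ih he he' with h | ⟨pre, h, h'⟩ | ⟨pre, h, h'⟩
      exacts [.inl h, .inr (.inl ⟨pre, h.append _, h'⟩), .inr (.inr ⟨pre, h.append _, h'⟩)]
    · exact .inr (.inr ⟨l, ⟨⟨[], rfl⟩, rfl⟩, he⟩)
    · exact .inr (.inl ⟨l, ⟨⟨[], rfl⟩, rfl⟩, he'⟩)
    · exact .inl rfl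

theorem rcv_run (l : List (Tx V k)) (v : V) :
    ((run G A s l).rcv v = (init k s).rcv v ∧ ∀ J ∈ l, v ∉ J.targets) ∨
      ∃ e ∈ (run G A s l).log, v ∈ e.1.targets ∧ (run G A s l).rcv v = (e.2 : ℕ∞) := by
  induction l using List.reverseRecOn with
  | nil => exact .inl ⟨rfl, by simp⟩
  | append_singleton l J ih =>
    rw [log_run_append_singleton, run_append_singleton]
    by_cases hv : v ∈ J.targets
    · exact .inr ⟨_, List.mem_append_right _ List.mem_cons_self, hv, by simp [step, hv]⟩
    · rcases ih with ⟨h, h'⟩ | ⟨e, he, hev, h⟩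
      · left
        refine ⟨by simpa [step, hv] using h, fun J' hJ' => ?_⟩
        rcases List.mem_append.1 hJ' with h | h
        · exact h' J' h
        · rwa [List.mem_singleton.1 h]
      · exact .inr ⟨e, List.mem_append_left _ he, hev, by simpa [step, hv] using h⟩

theorem rcv_run_eq_coe {v : V} {t : ℕ} (h : (run G A s l).rcv v = (t : ℕ∞)) :
    v = s ∧ t = 0 ∨ ∃ e ∈ (run G A s l).log, v ∈ e.1.targets ∧ e.2 = t := by
  rcases rcv_run (G := G) (A := A) (s := s) l v with ⟨h', -⟩ | ⟨e, he, hv, h'⟩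
  · left
    rw [h'] at h
    by_cases hv : v = s
    · refine ⟨hv, ?_⟩
      simp only [init, hv, if_true] at h
      exact_mod_cast h.symm
    · simp [init, hv] at h
  · refine .inr ⟨e, he, hv, ?_⟩
    rw [h'] at h
    exact_mod_cast h

theorem eq_of_mem_targets (hl : l.Pairwise fun J J' => Disjoint J.targets J'.targets)
    {v : V} (he : e ∈ (run G A s l).log) (he' : e' ∈ (run G A s l).log) (hv : v ∈ e.1.targets)
    (hv' : v ∈ e'.1.targets) : e = e' := by
  by_contra hne
  have hp : (run G A s l).log.Pairwise fun a b => Disjoint a.1.targets b.1.targets := by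
    rw [← map_fst_log_run (G := G) (A := A) (s := s) l, List.pairwise_map] at hl
    exact hl
  have : Std.Symm fun a b : Tx V k × ℕ => Disjoint a.1.targets b.1.targets :=
    ⟨fun a b h => h.symm⟩
  exact Finset.disjoint_left.1 (hp.forall he he' hne) hv hv'

/-- `step` overwrites reception times; disjointness of the targets ensures that this happens at most
once per node. -/
theorem rcv_run_of_mem (hl : l.Pairwise fun J J' => Disjoint J.targets J'.targets)
    {v : V} (he : e ∈ (run G A s l).log) (hv : v ∈ e.1.targets) :
    (run G A s l).rcv v = (e.2 : ℕ∞) := by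
  rcases rcv_run (G := G) (A := A) (s := s) l v with ⟨-, h⟩ | ⟨e', he', hv', h⟩
  · exact absurd hv (h _ (fst_mem_of_mem_log he))
  · rw [h, eq_of_mem_targets hl he he' hv hv']

/-- All large slots are free, since only finitely many are in use. Hence the infimum in
`earliestSlot` is attained and is not the default value 0. -/
theorem exists_slotFree [Finite V] (st : State V k) (J : Tx V k) (hr : st.rcv J.node ≠ ⊤) :
    ∃ t, SlotFree G A st J t := by
  have h1 : ∀ᶠ t : ℕ in Filter.atTop, st.rcv J.node < (t : ℕ∞) := by
    obtain ⟨n, hn⟩ := ENat.ne_top_iff_exists.1 hr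
    filter_upwards [Filter.eventually_gt_atTop n] with t ht
    rw [← hn]
    exact_mod_cast ht
  have h2 : ∀ᶠ t : ℕ in Filter.atTop, ∀ w, st.rcv w ≠ (t : ℕ∞) := by
    refine Filter.eventually_all.2 fun w => ?_
    by_cases hw : st.rcv w = ⊤
    · exact Filter.Eventually.of_forall fun t => by simp [hw]
    · obtain ⟨n, hn⟩ := ENat.ne_top_iff_exists.1 hw
      filter_upwards [Filter.eventually_ne_atTop n] with t ht
      rw [← hn]
      exact_mod_cast ht.symm
  have h3 : ∀ᶠ t : ℕ in Filter.atTop, ∀ e ∈ {e | e ∈ st.log}, e.2 ≠ t :=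
    (Filter.eventually_all_finite (List.finite_toSet st.log)).2 fun e _ =>
      (Filter.eventually_ne_atTop e.2).mono fun t ht => ht.symm
  obtain ⟨t, h1, h2, h3⟩ := (h1.and (h2.and h3)).exists
  exact ⟨t, h1, fun w _ _ => h2 w, fun v _ e he het => absurd het (h3 e he),
    fun e he _ _ => h3 e he⟩

theorem le_lastSlot {L : List (Tx V k × ℕ)} (he : e ∈ L) : e.2 ≤ lastSlot L := by
  induction L with
  | nil => simp at he
  | cons a L ih =>
    change e.2 ≤ max a.2 (lastSlot L)
    rcases List.mem_cons.1 he with rfl | h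
    exacts [le_max_left _ _, (ih h).trans (le_max_right _ _)]

theorem lastSlot_le {L : List (Tx V k × ℕ)} {b : ℕ} (h : ∀ e ∈ L, e.2 ≤ b) :
    lastSlot L ≤ b := by
  induction L with
  | nil => exact Nat.zero_le b
  | cons a L ih =>
    exact max_le (h a List.mem_cons_self) (ih fun e he => h e (List.mem_cons_of_mem _ he))

/-- If all slots after `b` outside a set of `n` slots are free, then the earliest free slot is at
most `b + n + 1`. -/
theorem earliestSlot_le {st : State V k} {J : Tx V k} {b n : ℕ} (B : Finset ℕ) (hB : B.card ≤ n)
    (h : ∀ t, b < t → t ∉ B → SlotFree G A st J t) : earliestSlot G A st J ≤ b + n + 1 := by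
  -- Pigeonhole: `n + 1` candidate slots, at most `n` of them blocked.
  obtain ⟨t, ht, htB⟩ : ∃ t ∈ Finset.Icc (b + 1) (b + n + 1), t ∉ B := by
    refine Finset.exists_mem_notMem_of_card_lt_card ?_
    rw [Nat.card_Icc]
    omega
  rw [Finset.mem_Icc] at ht
  exact (Nat.sInf_le (h t ht.1 htB)).trans ht.2

end Scheduler

/-! ### Collision-freeness, causality and the spanning tree. -/

section Correctness

open scoped Classical

variable {V : Type*} [Fintype V] {k : ℕ} {G : SimpleGraph V} {A : V → Fin k} {s : V}
  {τ : TieBreak V} {e e' : Tx V k × ℕ} {pre : List (Tx V k)} {v : V}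

theorem pairwise_disjoint_plan :
    (plan G A s τ).Pairwise fun J J' => Disjoint J.targets J'.targets :=
  pairwise_before_plan.imp Before.disjoint

theorem fst_mem_plan (he : e ∈ output G A s τ) : e.1 ∈ plan G A s τ := fst_mem_of_mem_log he

theorem PlacedAfter.mem_output_of_mem (h : PlacedAfter G A s (plan G A s τ) e pre)
    (he' : e' ∈ (run G A s pre).log) : e' ∈ output G A s τ :=
  h.log_subset he'

theorem PlacedAfter.pairwise_disjoint (h : PlacedAfter G A s (plan G A s τ) e pre) :
    pre.Pairwise fun J J' => Disjoint J.targets J'.targets := by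
  obtain ⟨⟨post, hp⟩, -⟩ := h
  have := pairwise_disjoint_plan (G := G) (A := A) (s := s) (τ := τ)
  rw [hp, List.pairwise_append] at this
  exact this.1

theorem PlacedAfter.before (h : PlacedAfter G A s (plan G A s τ) e pre)
    (he' : e' ∈ (run G A s pre).log) : Before G A s τ e'.1 e.1 := by
  obtain ⟨⟨post, hp⟩, -⟩ := h
  have := pairwise_before_plan (G := G) (A := A) (s := s) (τ := τ)
  rw [hp, List.pairwise_append] at this
  exact this.2.2 _ (fst_mem_of_mem_log he') _ List.mem_cons_self

/-- When a transmission is scheduled, its node is the source, or has a reception time. -/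
theorem PlacedAfter.rcv_node (hconn : G.Connected)
    (h : PlacedAfter G A s (plan G A s τ) e pre) :
    e.1.node = s ∧ (run G A s pre).rcv e.1.node = 0 ∨ ∃ e' ∈ (run G A s pre).log,
      e.1.node ∈ e'.1.targets ∧ (run G A s pre).rcv e.1.node = (e'.2 : ℕ∞) := by
  have hdis := h.pairwise_disjoint
  obtain ⟨⟨post, hp⟩, -⟩ := h
  rcases rcv_run (G := G) (A := A) (s := s) pre e.1.node with ⟨h1, h2⟩ | h1
  · rcases exists_earlier_target hconn hp with hs | ⟨J, hJ, hJt⟩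
    · exact .inl ⟨hs, by rw [h1]; simp [init, hs]⟩
    · exact absurd hJt (h2 J hJ)
  · exact .inr h1

theorem PlacedAfter.slotFree (hconn : G.Connected)
    (h : PlacedAfter G A s (plan G A s τ) e pre) : SlotFree G A (run G A s pre) e.1 e.2 := by
  rw [h.2]
  refine Nat.sInf_mem (s := {t | SlotFree G A (run G A s pre) e.1 t}) (exists_slotFree _ _ ?_)
  rcases h.rcv_node hconn with ⟨-, h⟩ | ⟨e', -, -, h⟩ <;> simp [h]

theorem node_eq_source_or_exists_lt (hconn : G.Connected) (he : e ∈ output G A s τ) :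
    e.1.node = s ∨ ∃ e' ∈ output G A s τ, e.1.node ∈ e'.1.targets ∧ e'.2 < e.2 := by
  obtain ⟨pre, h⟩ := exists_placedAfter he
  rcases h.rcv_node hconn with ⟨hs, -⟩ | ⟨e', he', ht, hr⟩
  · exact .inl hs
  · refine .inr ⟨e', h.mem_output_of_mem he', ht, ?_⟩
    have := (h.slotFree hconn).1
    rw [hr] at this
    exact_mod_cast this

theorem one_le_slot (hconn : G.Connected) (he : e ∈ output G A s τ) : 1 ≤ e.2 := by
  obtain ⟨pre, h⟩ := exists_placedAfter he
  have := lt_of_le_of_lt zero_le (h.slotFree hconn).1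
  exact_mod_cast this

theorem eq_of_mem_output (he : e ∈ output G A s τ) (he' : e' ∈ output G A s τ)
    (hv : v ∈ e.1.targets) (hv' : v ∈ e'.1.targets) : e = e' :=
  eq_of_mem_targets pairwise_disjoint_plan he he' hv hv'

theorem existsUnique_mem_output (hconn : G.Connected) (hv : v ≠ s) :
    ∃! e, e ∈ output G A s τ ∧ v ∈ e.1.targets := by
  obtain ⟨J, hJ, hvJ⟩ := exists_mem_plan_target (A := A) (τ := τ) hconn hv
  obtain ⟨t, ht⟩ := exists_mem_log (G := G) (A := A) (s := s) hJ
  exact ⟨(J, t), ⟨ht, hvJ⟩, fun e he => eq_of_mem_output he.1 ht he.2 hvJ⟩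

/-- A node transmits only after its reception. -/
theorem lt_of_mem_targets (hconn : G.Connected) (he : e ∈ output G A s τ)
    (he' : e' ∈ output G A s τ) (h : e'.1.node ∈ e.1.targets) : e.2 < e'.2 := by
  rcases node_eq_source_or_exists_lt hconn he' with hs | ⟨e₁, he₁, h₁, hlt⟩
  · exact absurd (hs ▸ h) (source_notMem_targets (fst_mem_plan he))
  · rwa [eq_of_mem_output he he₁ h h₁]

/-- The receiver is silent because it transmits only after its reception. A disturbing entry placed
before `e` violates the third clause of `SlotFree` for `e`; one placed after `e` violates the second
clause for itself. -/
theorem receives_schedule (hconn : G.Connected) (he : e ∈ output G A s τ)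
    (hv : v ∈ e.1.targets) : Receives G A (schedule G A s τ) e.2 e.1.node v := by
  have hch := chan_of_mem_plan (fst_mem_plan he) hv
  refine ⟨adj_of_mem_plan (fst_mem_plan he) hv, ⟨e, he, rfl, rfl, hch.symm⟩, ?_, ?_⟩
  · rintro c ⟨e', he', ht, hn, -⟩
    have := lt_of_mem_targets hconn he he' (hn ▸ hv)
    omega
  · rintro x hx ⟨e', he', ht, hn, hc⟩
    simp only at hn hc
    rcases eq_or_placedAfter he he' with rfl | ⟨pre, hp, hm⟩ | ⟨pre, hp, hm⟩
    · exact hn.symm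
    · by_contra hne
      exact (hp.slotFree hconn).2.2.1 v hv e' hm ht (hc.trans hch) (hn ▸ hne) (hn ▸ hx)
    · refine absurd ?_ ((hp.slotFree hconn).2.1 v (hn ▸ hx) hc.symm)
      rw [rcv_run_of_mem hp.pairwise_disjoint hm hv, ht]

theorem isBroadcastSchedule_schedule (hconn : G.Connected) :
    IsBroadcastSchedule G A s (schedule G A s τ) (latency G A s τ) where
  slots := by
    rintro t x ⟨e, he, rfl, -⟩
    exact ⟨one_le_slot hconn he, le_lastSlot he⟩
  single_radio := by
    rintro t u c d ⟨e, he, rfl, rfl, rfl⟩ ⟨e', he', ht, hn, rfl⟩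
    by_contra hne
    simp only at hn hne
    rcases eq_or_placedAfter he he' with rfl | ⟨pre, hp, hm⟩ | ⟨pre, hp, hm⟩
    · exact hne rfl
    · exact (hp.slotFree hconn).2.2.2 e' hm hn (Ne.symm hne) ht
    · exact (hp.slotFree hconn).2.2.2 e hm hn.symm hne ht.symm
  causal := by
    rintro t u c ⟨e, he, rfl, rfl, -⟩
    refine (node_eq_source_or_exists_lt hconn he).imp id ?_
    rintro ⟨e', he', ht, hlt⟩
    exact ⟨e'.2, hlt, _, receives_schedule hconn he' ht⟩
  complete v := by
    by_cases hv : v = s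
    · exact .inl hv
    · obtain ⟨e, ⟨he, ht⟩, -⟩ := existsUnique_mem_output (A := A) (τ := τ) hconn hv
      exact .inr ⟨e.2, Nat.lt_succ_of_le (le_lastSlot he), _, receives_schedule hconn he ht⟩

theorem tree_le : tree G A s τ ≤ G := by
  rintro a b ⟨-, ⟨J, hJ, rfl, h⟩ | ⟨J, hJ, rfl, h⟩⟩
  exacts [adj_of_mem_plan hJ h, (adj_of_mem_plan hJ h).symm]

theorem tree_adj_of_mem_targets {J : Tx V k} (hJ : J ∈ plan G A s τ) (hv : v ∈ J.targets) :
    (tree G A s τ).Adj J.node v :=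
  ⟨(adj_of_mem_plan hJ hv).ne, .inl ⟨J, hJ, rfl, hv⟩⟩

theorem tree_reachable_of_mem_targets (hconn : G.Connected) (he : e ∈ output G A s τ)
    (hv : v ∈ e.1.targets) : (tree G A s τ).Reachable s v := by
  induction hn : e.2 using Nat.strong_induction_on generalizing e v with
  | _ n ih =>
    subst hn
    have h1 := (tree_adj_of_mem_targets (fst_mem_plan he) hv).reachable
    rcases node_eq_source_or_exists_lt hconn he with hs | ⟨e', he', h', hlt⟩
    · rwa [hs] at h1
    · exact (ih _ hlt he' h' rfl).trans h1

theorem tree_connected (hconn : G.Connected) : (tree G A s τ).Connected := by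
  rw [SimpleGraph.connected_iff_exists_forall_reachable]
  refine ⟨s, fun v => ?_⟩
  by_cases hv : v = s
  · rw [hv]
  · obtain ⟨e, ⟨he, ht⟩, -⟩ := existsUnique_mem_output (A := A) (τ := τ) hconn hv
    exact tree_reachable_of_mem_targets hconn he ht

/-- Every edge joins some node other than `s` to its unique parent, so there are at most `|V| - 1`
edges; with connectedness this makes `tree` a tree. -/
theorem card_edgeSet_tree_lt (hconn : G.Connected) :
    Nat.card (tree G A s τ).edgeSet + 1 ≤ Nat.card V := by
  have hpar : ∀ v, ∃ u, v ≠ s → ∀ J ∈ plan G A s τ, v ∈ J.targets → J.node = u := by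
    intro v
    by_cases hv : v = s
    · exact ⟨s, fun h => absurd hv h⟩
    · obtain ⟨e, -, hu⟩ := existsUnique_mem_output (A := A) (τ := τ) hconn hv
      refine ⟨e.1.node, fun _ J hJ hvJ => ?_⟩
      obtain ⟨t, ht⟩ := exists_mem_log (G := G) (A := A) (s := s) hJ
      rw [← hu _ ⟨ht, hvJ⟩]
  choose par hpar using hpar
  have hsub : (tree G A s τ).edgeSet
      ⊆ ((Finset.univ.erase s).image fun v => s(par v, v) : Finset (Sym2 V)) := by
    have key : ∀ a b, (∃ J ∈ plan G A s τ, J.node = a ∧ b ∈ J.targets) →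
        s(a, b) ∈ (Finset.univ.erase s).image fun v => s(par v, v) := by
      rintro a b ⟨J, hJ, rfl, hb⟩
      have hbs : b ≠ s := by
        rintro rfl
        exact source_notMem_targets hJ hb
      refine Finset.mem_image.2 ⟨b, Finset.mem_erase.2 ⟨hbs, Finset.mem_univ b⟩, ?_⟩
      rw [hpar b hbs J hJ hb]
    intro x
    induction x using Sym2.ind with
    | _ a b =>
      rintro ⟨-, h | h⟩
      · exact key a b h
      · rw [Sym2.eq_swap]
        exact key b a h
  have h1 := Set.ncard_le_ncard hsub (Finset.finite_toSet _)
  rw [Set.ncard_coe_finset] at h1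
  have h2 := h1.trans Finset.card_image_le
  rw [Finset.card_erase_of_mem (Finset.mem_univ s), Finset.card_univ] at h2
  have h3 : 0 < Fintype.card V := Fintype.card_pos_iff.2 ⟨s⟩
  rw [Nat.card_coe_set_eq, Nat.card_eq_fintype_card]
  omega

theorem isTree_tree (hconn : G.Connected) : (tree G A s τ).IsTree := by
  have h := tree_connected (A := A) (s := s) (τ := τ) hconn
  exact SimpleGraph.isTree_iff_connected_and_card.2
    ⟨h, le_antisymm (card_edgeSet_tree_lt hconn) h.card_vert_le_card_edgeSet_add_one⟩

theorem IsBroadcastSchedule.depth_le {S : Schedule V k} {T : ℕ} (hconn : G.Connected)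
    (hS : IsBroadcastSchedule G A s S T) : depth G s ≤ T :=
  Finset.sup_le fun v _ => (hS.complete v).dist_le hconn hS

end Correctness

end ETS

namespace ETS

/-! ### Counting blocked slots, layer by layer. -/

section Latency

open scoped Classical

variable {V : Type*} [Fintype V] {k : ℕ} {G : SimpleGraph V} {A : V → Fin k} {s : V}
  {τ : TieBreak V} {e e' : Tx V k × ℕ} {pre : List (Tx V k)} {v : V} {i : ℕ} {c d : Fin k}
  {J J' : Tx V k}

theorem Before.irrefl : ¬ Before G A s τ J J := fun h => by
  cases h with
  | layer hij h' h => exact hij.ne (h'.unique h).1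
  | chan hcd h' h => exact hcd (h'.unique h).2
  | kind h' h => exact not_mem_dominators_of_mem_connectors h' h
  | conn _ _ hr => exact hr.ne rfl
  | dom _ _ hr => exact hr.ne rfl

theorem eq_of_fst_eq (he : e ∈ output G A s τ) (he' : e' ∈ output G A s τ)
    (h : e.1 = e'.1) : e = e' := by
  rcases eq_or_placedAfter he he' with h' | ⟨pre, hp, hm⟩ | ⟨pre, hp, hm⟩
  · exact h'
  · exact absurd (h ▸ hp.before hm) Before.irrefl
  · exact absurd (h ▸ hp.before hm) Before.irrefl

theorem eq_of_node_eq_of_mem_dominators (hJ : J ∈ dominators G A s τ i c)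
    (hJ' : J' ∈ dominators G A s τ i c) (h : J.node = J'.node) : J = J' := by
  by_contra hne
  have : Std.Symm fun J J' : Tx V k => J.node ≠ J'.node := ⟨fun a b h => h.symm⟩
  exact (((domSpec_dominators i c).rel).imp DomRel.ne).forall hJ hJ' hne h

theorem eq_of_node_eq_of_mem_connectors (hJ : J ∈ connectors G A s τ i c)
    (hJ' : J' ∈ connectors G A s τ i c) (h : J.node = J'.node) : J = J' := by
  by_contra hne
  have : Std.Symm fun J J' : Tx V k => J.node ≠ J'.node := ⟨fun a b h => h.symm⟩
  exact (((connSpec_connectors i c).rel).imp ConnRel.ne).forall hJ hJ' hne h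

theorem le_finishTime (he : e ∈ output G A s τ) (h : G.dist s e.1.node = i) :
    e.2 ≤ finishTime G A s τ i :=
  le_lastSlot (List.mem_filter.2 ⟨he, by simpa using mem_layer.2 h⟩)

/-- All nodes of a layer have been served when its transmissions are finished. -/
theorem le_finishTime_of_mem_targets (hconn : G.Connected) (he : e ∈ output G A s τ)
    (hv : v ∈ e.1.targets) (hi : G.dist s v = i) : e.2 ≤ finishTime G A s τ i := by
  obtain ⟨j, hj, c, hb⟩ := mem_plan.1 (fst_mem_plan he)
  have hij : i = j + 1 := hi.symm.trans (hb.dist_target hv)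
  subst hij
  rcases hb with hb | hb
  -- A child of a connector is a dominator, which transmits later even if it has no children.
  · obtain ⟨J, hJ, rfl⟩ := target_of_mem_connectors hb hv
    obtain ⟨t, ht⟩ := exists_mem_log (G := G) (A := A) (s := s)
      (mem_plan.2 ⟨j, hj, c, .inr hJ⟩ : J ∈ plan G A s τ)
    exact (lt_of_mem_targets hconn he ht hv).le.trans (le_finishTime ht hi)
  · exact le_finishTime he (dist_node_of_mem_dominators hb)

/-- A dominator competes for slots with at most nineteen others. -/
theorem card_competing_dominators_le (hG : IsUnitDiskGraph G) (hconn : G.Connected)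
    (hJ : J ∈ dominators G A s τ (i + 1) c) (N : Finset V)
    (hN : ∀ x ∈ N, x ≠ J.node ∧ (∃ J' ∈ dominators G A s τ (i + 1) c, J'.node = x) ∧
      ∃ y, G.Adj x y ∧ G.Adj y J.node) : N.card ≤ 19 := by
  have hu := dist_node_of_mem_dominators hJ
  have hNd : ∀ x ∈ N, G.dist s x = i + 1 := fun x hx => by
    obtain ⟨-, ⟨J', hJ', rfl⟩, -⟩ := hN x hx
    exact dist_node_of_mem_dominators hJ'
  have hind : ∀ x ∈ N, ∀ y ∈ N, x ≠ y → ¬ G.Adj x y := fun x hx y hy _ => by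
    obtain ⟨-, ⟨J', hJ', rfl⟩, -⟩ := hN x hx
    obtain ⟨-, ⟨J'', hJ'', rfl⟩, -⟩ := hN y hy
    exact not_adj_of_mem_dominators hJ' hJ''
  cases i with
  | zero =>
    -- Layer 1 has no grandparent, but its dominators are independent neighbours of `s`.
    refine (hG.card_le_five s N (fun x hx => ?_) hind).trans (by norm_num)
    exact SimpleGraph.dist_eq_one_iff_adj.1 (hNd x hx)
  | succ i =>
    -- The grandparent `q`, two layers back, is at two hops and adjacent to no competitor; it
    -- occupies one of the twenty places, whence 19.
    obtain ⟨p, hpu, hp⟩ := exists_adj_of_dist_eq_succ hconn hu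
    obtain ⟨q, hqp, hq⟩ := exists_adj_of_dist_eq_succ hconn hp
    have hfar : ∀ x, G.dist s x = i + 1 + 1 → q ≠ x ∧ ¬ G.Adj q x := fun x hx => by
      refine ⟨?_, fun h => ?_⟩
      · rintro rfl; omega
      · have := dist_le_dist_add_one (s := s) hconn h
        omega
    have hqN : q ∉ N := fun h => (hfar q (hNd q h)).1 rfl
    have := hG.card_le_twenty J.node (insert q N) ?_ ?_ ?_ ?_
    · rw [Finset.card_insert_of_notMem hqN] at this
      omega
    · refine Finset.forall_mem_insert _ _ _ |>.2 ⟨(hfar _ hu).1, fun x hx => (hN x hx).1⟩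
    · refine Finset.forall_mem_insert _ _ _ |>.2 ⟨(hfar _ hu).2, fun x hx => ?_⟩
      obtain ⟨-, ⟨J', hJ', rfl⟩, -⟩ := hN x hx
      exact not_adj_of_mem_dominators hJ' hJ
    · exact Finset.forall_mem_insert _ _ _ |>.2 ⟨⟨p, hqp, hpu⟩, fun x hx => (hN x hx).2.2⟩
    · intro x hx y hy hxy
      rcases Finset.mem_insert.1 hx with rfl | hx' <;>
        rcases Finset.mem_insert.1 hy with rfl | hy'
      · exact absurd rfl hxy
      · exact (hfar y (hNd y hy')).2
      · exact fun h => (hfar x (hNd x hx')).2 h.symm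
      · exact hind x hx' y hy' hxy

/-- After `finishTime i`, layer `i` is silent and already served, and earlier layers are too far
away to matter. A slot can be blocked only by the competing dominators collected in `E`. The radio
causes no conflict: a dominator uses its own reception channel, and its connector role is planned
only in the next round. -/
theorem dominator_slot_le (hG : IsUnitDiskGraph G) (hconn : G.Connected)
    (he : e ∈ output G A s τ) (hJ : e.1 ∈ dominators G A s τ (i + 1) c) :
    e.2 ≤ finishTime G A s τ i + 20 := by
  obtain ⟨pre, hp⟩ := exists_placedAfter he
  have hu := dist_node_of_mem_dominators hJ
  have hchan := (domSpec_dominators (i + 1) c).chan_eq _ hJ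
  set E : Finset (Tx V k × ℕ) := (run G A s pre).log.toFinset.filter fun e' =>
    e'.1 ∈ dominators G A s τ (i + 1) c ∧ e'.1.node ≠ e.1.node ∧
      ∃ y, G.Adj e'.1.node y ∧ G.Adj y e.1.node with hE
  have hEcard : E.card ≤ 19 := by
    have hinj : Set.InjOn (fun e' : Tx V k × ℕ => e'.1.node) E := by
      intro a ha b hb hab
      simp only [hE, Finset.coe_filter, List.mem_toFinset, Set.mem_ofPred_eq] at ha hb
      exact eq_of_fst_eq (hp.mem_output_of_mem ha.1) (hp.mem_output_of_mem hb.1)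
        (eq_of_node_eq_of_mem_dominators ha.2.1 hb.2.1 hab)
    rw [← Finset.card_image_of_injOn hinj]
    refine card_competing_dominators_le hG hconn hJ _ fun x hx => ?_
    obtain ⟨a, ha, rfl⟩ := Finset.mem_image.1 hx
    simp only [hE, Finset.mem_filter] at ha
    exact ⟨ha.2.2.1, ⟨_, ha.2.1, rfl⟩, ha.2.2.2⟩
  rw [hp.2]
  refine earliestSlot_le (E.image Prod.snd) (Finset.card_image_le.trans hEcard) fun t ht htB => ?_
  have hnot : ∀ e' ∈ (run G A s pre).log, e'.2 = t → e'.1.chan = c → ∀ y,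
      G.Adj e'.1.node y → G.Adj y e.1.node → G.dist s e'.1.node ≤ i := by
    intro e' he' het hc y h1 h2
    rcases (hp.before he').of_mem_dominators hJ with h | ⟨d, hd, h⟩ | ⟨h, hr⟩
    · exact h
    · exact absurd (((domSpec_dominators _ _).chan_eq _ h).symm.trans hc) hd
    · refine absurd (Finset.mem_image.2 ⟨e', ?_, het⟩) htB
      simp only [hE, Finset.mem_filter, List.mem_toFinset]
      exact ⟨he', h, hr.ne, y, h1, h2⟩
  refine ⟨?_, fun w hw hAw hr => ?_, fun v hv e' he' het hc hne hadj => ?_,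
    fun e' he' hn hc het => ?_⟩
  · rcases hp.rcv_node hconn with ⟨-, h⟩ | ⟨e', he', hm, h⟩
    · rw [h]
      exact_mod_cast Nat.zero_lt_of_lt ht
    · rw [h]
      refine Nat.cast_lt.2 (lt_of_le_of_lt ?_ ht)
      have he'o := hp.mem_output_of_mem he'
      rcases (hp.before he').of_mem_dominators hJ with h | ⟨d, hd, h⟩ | ⟨h, hr⟩
      · have h1 := dist_le_dist_add_one (s := s) hconn (adj_of_mem_plan (fst_mem_plan he'o) hm)
        exact le_finishTime he'o (by omega)
      · exact absurd ((chan_target_of_mem_dominators h hm).symm.trans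
          (chan_node_of_mem_dominators hJ)) hd
      · exact absurd hm ((domSpec_dominators _ _).node_notMem _ hJ _ h)
  · obtain ⟨-, rfl⟩ | ⟨e', he', hm, rfl⟩ := rcv_run_eq_coe hr
    · omega
    have he'o := hp.mem_output_of_mem he'
    have hadj := adj_of_mem_plan (fst_mem_plan he'o) hm
    have hle := hnot e' he' rfl ((chan_of_mem_plan (fst_mem_plan he'o) hm).symm.trans
      (hAw.trans hchan)) w hadj hw.symm
    have h1 := dist_le_dist_add_one (s := s) hconn hadj
    have h2 := dist_le_dist_add_one (s := s) hconn hw.symm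
    -- `w` lies in layer `i` or beyond, and its server in layer `i` at most; so the receiver or the
    -- sender is in layer `i`, which is finished.
    rcases (by omega : G.dist s w = i ∨ G.dist s e'.1.node = i) with h | h
    · exact ht.not_ge (le_finishTime_of_mem_targets hconn he'o hm h)
    · exact ht.not_ge (le_finishTime he'o h)
  · have hle := hnot e' he' het (hc.trans hchan) v hadj (adj_of_mem_plan (fst_mem_plan he) hv).symm
    have h1 := dist_le_dist_add_one (s := s) hconn hadj
    have h2 := dist_target_of_mem_dominators hJ hv
    subst het
    exact ht.not_ge (le_finishTime (hp.mem_output_of_mem he') (by omega))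
  · rcases (hp.before he').of_mem_dominators hJ with h | ⟨d, hd, h⟩ | ⟨h, hr⟩
    · rw [hn] at h
      omega
    · exact hd ((chan_node_of_mem_dominators h).symm.trans
        (hn ▸ chan_node_of_mem_dominators hJ))
    · exact hr.ne hn

/-- The reception time of a node of layer `i + 1`. -/
theorem le_finishTime_add_of_mem_targets (hG : IsUnitDiskGraph G) (hconn : G.Connected)
    (he : e ∈ output G A s τ) (hv : v ∈ e.1.targets) (hi : G.dist s v = i + 1) :
    e.2 ≤ finishTime G A s τ i + 20 := by
  obtain ⟨j, hj, c, hb⟩ := mem_plan.1 (fst_mem_plan he)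
  have hij : i + 1 = j + 1 := hi.symm.trans (hb.dist_target hv)
  obtain rfl : i = j := by omega
  rcases hb with hb | hb
  · exact (le_finishTime he (dist_node_of_mem_connectors hb)).trans (Nat.le_add_right _ _)
  · exact dominator_slot_le hG hconn he hb

/-- The entries of `L` in which `u` is a connector of layer `i` on another channel than `c`. -/
noncomputable def otherChannels (G : SimpleGraph V) (A : V → Fin k) (s : V) (τ : TieBreak V)
    (i : ℕ) (c : Fin k) (u : V) (L : List (Tx V k × ℕ)) : Finset (Tx V k × ℕ) :=
  L.toFinset.filter fun e => e.1.node = u ∧ ∃ d ≠ c, e.1 ∈ connectors G A s τ i d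

theorem card_otherChannels_le (u : V) {L : List (Tx V k × ℕ)} (hL : ∀ e ∈ L, e ∈ output G A s τ) :
    (otherChannels G A s τ i c u L).card ≤ k - 1 := by
  have h : (otherChannels G A s τ i c u L).card ≤ (Finset.univ.erase c).card := by
    refine Finset.card_le_card_of_injOn (fun e => e.1.chan) (fun a ha => ?_) fun a ha b hb hab => ?_
    · simp only [otherChannels, Finset.coe_filter, Set.mem_ofPred_eq] at ha
      obtain ⟨-, -, d, hd, h⟩ := ha
      change a.1.chan ∈ Finset.univ.erase c
      rw [(connSpec_connectors i d).chan_eq _ h]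
      exact Finset.mem_erase.2 ⟨hd, Finset.mem_univ d⟩
    · simp only [otherChannels, Finset.coe_filter, List.mem_toFinset, Set.mem_ofPred_eq] at ha hb
      obtain ⟨ha, hau, d, hd, had⟩ := ha
      obtain ⟨hb, hbu, d', hd', hbd⟩ := hb
      simp only [(connSpec_connectors i d).chan_eq _ had,
        (connSpec_connectors i d').chan_eq _ hbd] at hab
      subst hab
      exact eq_of_fst_eq (hL a ha) (hL b hb)
        (eq_of_node_eq_of_mem_connectors had hbd (hau.trans hbu.symm))
  rwa [Finset.card_erase_of_mem (Finset.mem_univ c), Finset.card_univ, Fintype.card_fin] at h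

/-- At most three earlier connectors serve neighbours of a connector on its channel. -/
theorem card_competing_connectors_le (hG : IsUnitDiskGraph G) (hconn : G.Connected)
    (hJ : J ∈ connectors G A s τ (i + 1) c) (E : Finset (Tx V k × ℕ))
    (hEo : ∀ e ∈ E, e ∈ output G A s τ) (hE : ∀ e ∈ E, e.1 ∈ connectors G A s τ (i + 1) c ∧
      Disjoint e.1.targets J.targets ∧ ∃ w ∈ e.1.targets, G.Adj J.node w) : E.card ≤ 3 := by
  have : Nonempty V := ⟨s⟩
  have hu := dist_node_of_mem_connectors hJ
  -- One child per competitor, a child `w₀` of `J` and a node `p` of the previous layer are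
  -- independent neighbours of `J.node`; at most five in all leaves three competitors.
  choose! w hw hwu using fun e he => (hE e he).2.2
  obtain ⟨w₀, hw₀⟩ := (connSpec_connectors _ _).nonempty _ hJ
  obtain ⟨p, hpu, hp⟩ := exists_adj_of_dist_eq_succ hconn hu
  have hinj : Set.InjOn w E := fun a ha b hb hab =>
    eq_of_mem_output (hEo a ha) (hEo b hb) (hw a ha) (hab ▸ hw b hb)
  have hw₀E : w₀ ∉ E.image w := fun h => by
    obtain ⟨a, ha, rfl⟩ := Finset.mem_image.1 h
    exact Finset.disjoint_left.1 (hE a ha).2.1 (hw a ha) hw₀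
  have hdom : ∀ x ∈ insert w₀ (E.image w),
      ∃ J' ∈ dominators G A s τ (i + 1 + 1) c, J'.node = x := by
    refine Finset.forall_mem_insert _ _ _ |>.2 ⟨target_of_mem_connectors hJ hw₀, fun x hx => ?_⟩
    obtain ⟨a, ha, rfl⟩ := Finset.mem_image.1 hx
    exact target_of_mem_connectors (hE a ha).1 (hw a ha)
  have hfar : ∀ x ∈ insert w₀ (E.image w), p ≠ x ∧ ¬ G.Adj p x := fun x hx => by
    obtain ⟨J', hJ', rfl⟩ := hdom x hx
    have hd := dist_node_of_mem_dominators hJ'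
    refine ⟨fun h => ?_, fun h => ?_⟩
    · rw [← h] at hd; omega
    · have := dist_le_dist_add_one (s := s) hconn h
      omega
  have hpE : p ∉ insert w₀ (E.image w) := fun h => (hfar p h).1 rfl
  have := hG.card_le_five J.node (insert p (insert w₀ (E.image w))) ?_ ?_
  · rw [Finset.card_insert_of_notMem hpE, Finset.card_insert_of_notMem hw₀E,
      Finset.card_image_of_injOn hinj] at this
    omega
  · refine Finset.forall_mem_insert _ _ _ |>.2 ⟨hpu.symm, Finset.forall_mem_insert _ _ _ |>.2
      ⟨(connSpec_connectors _ _).adj _ hJ _ hw₀, fun x hx => ?_⟩⟩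
    obtain ⟨a, ha, rfl⟩ := Finset.mem_image.1 hx
    exact hwu a ha
  · intro x hx y hy hxy
    rcases Finset.mem_insert.1 hx with rfl | hx' <;>
        rcases Finset.mem_insert.1 hy with rfl | hy'
    · exact absurd rfl hxy
    · exact (hfar y hy').2
    · exact fun h => (hfar x hx').2 h.symm
    · obtain ⟨J₁, h₁, rfl⟩ := hdom x hx'
      obtain ⟨J₂, h₂, rfl⟩ := hdom y hy'
      exact not_adj_of_mem_dominators h₁ h₂

/-- By `finishTime i + 20` all of layer `i + 1` has received. Afterwards, a slot is blocked either
by a same-channel connector with a child next to this one (`E`) or by the radio of the node itself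
(`F`). Earlier connectors never disturb the new children, by `ConnRel.not_adj`. -/
theorem connector_slot_le (hG : IsUnitDiskGraph G) (hconn : G.Connected)
    (he : e ∈ output G A s τ) (hJ : e.1 ∈ connectors G A s τ (i + 1) c) :
    e.2 ≤ finishTime G A s τ i + k + 23 := by
  obtain ⟨pre, hp⟩ := exists_placedAfter he
  have hu := dist_node_of_mem_connectors hJ
  have hchan := (connSpec_connectors (i + 1) c).chan_eq _ hJ
  set E : Finset (Tx V k × ℕ) := (run G A s pre).log.toFinset.filter fun e' =>
    e'.1 ∈ connectors G A s τ (i + 1) c ∧ Disjoint e'.1.targets e.1.targets ∧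
      ∃ w ∈ e'.1.targets, G.Adj e.1.node w with hE
  set F := otherChannels G A s τ (i + 1) c e.1.node (run G A s pre).log with hF
  have hEcard : E.card ≤ 3 := by
    refine card_competing_connectors_le hG hconn hJ E (fun a ha => ?_) fun a ha => ?_
    · exact hp.mem_output_of_mem (List.mem_toFinset.1 (Finset.mem_filter.1 ha).1)
    · exact (Finset.mem_filter.1 ha).2
  have hFcard : F.card ≤ k - 1 := card_otherChannels_le _ fun a ha => hp.mem_output_of_mem ha
  have hB : ((E ∪ F).image Prod.snd).card ≤ 3 + (k - 1) :=
    Finset.card_image_le.trans ((Finset.card_union_le _ _).trans (add_le_add hEcard hFcard))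
  -- The channel `c` exists, so `k - 1` is not truncated and 20 + (3 + (k - 1)) + 1 = k + 23.
  have hk : 1 ≤ k := c.pos
  have hmain : e.2 ≤ finishTime G A s τ i + 20 + (3 + (k - 1)) + 1 := ?_
  · omega
  rw [hp.2]
  refine earliestSlot_le _ hB fun t ht htB => ?_
  -- transmissions of the nodes up to layer `i`, and of the dominators of layer `i + 1`, are over
  have hcases : ∀ e' ∈ (run G A s pre).log, e'.2 = t → G.dist s e'.1.node < i ∨
      (∃ d ≠ c, e'.1 ∈ connectors G A s τ (i + 1) d) ∨
      (e'.1 ∈ connectors G A s τ (i + 1) c ∧ ConnRel G e'.1 e.1) ∨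
      (∃ d ≠ c, e'.1 ∈ dominators G A s τ (i + 1 + 1) d) := by
    intro e' he' het
    subst het
    refine ((hp.before he').of_mem_connectors hJ).imp_left ?_
    rintro ⟨j, hj, d, hb⟩
    have he'o := hp.mem_output_of_mem he'
    have h1 : G.dist s e'.1.node ≠ i := fun h => by
      have := le_finishTime he'o h
      omega
    rcases hb with hb | hb
    · have := dist_node_of_mem_connectors hb
      omega
    · have := dist_node_of_mem_dominators hb
      rcases (by omega : j < i ∨ j = i) with h | rfl
      · omega
      · exact absurd (dominator_slot_le hG hconn he'o hb) ht.not_ge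
  refine ⟨?_, fun w hw hAw hr => ?_, fun v hv e' he' het hc hne hadj => ?_,
    fun e' he' hn hc het => ?_⟩
  · rcases hp.rcv_node hconn with ⟨-, h⟩ | ⟨e', he', hm, h⟩
    · rw [h]
      exact_mod_cast Nat.zero_lt_of_lt ht
    · rw [h]
      exact Nat.cast_lt.2 (lt_of_le_of_lt
        (le_finishTime_add_of_mem_targets hG hconn (hp.mem_output_of_mem he') hm hu) ht)
  · obtain ⟨-, rfl⟩ | ⟨e', he', hm, het⟩ := rcv_run_eq_coe hr
    · omega
    have he'o := hp.mem_output_of_mem he'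
    have h1 := dist_le_dist_add_one (s := s) hconn hw.symm
    have hAw' := hAw.trans hchan
    rcases hcases e' he' het with h | ⟨d, hd, h⟩ | ⟨h, hr⟩ | ⟨d, hd, h⟩
    · have h2 := dist_le_dist_add_one (s := s) hconn (adj_of_mem_plan (fst_mem_plan he'o) hm)
      have := le_finishTime_of_mem_targets (i := i) hconn he'o hm (by omega)
      omega
    · exact hd ((chan_target_of_mem_connectors h hm).symm.trans hAw')
    · refine htB (Finset.mem_image.2 ⟨e', Finset.mem_union_left _ ?_, het⟩)
      simp only [hE, Finset.mem_filter, List.mem_toFinset]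
      exact ⟨he', h, hr.disjoint, w, hm, hw⟩
    · exact hd ((chan_target_of_mem_dominators h hm).symm.trans hAw')
  · rcases hcases e' he' het with h | ⟨d, hd, h⟩ | ⟨h, hr⟩ | ⟨d, hd, h⟩
    · have h1 := dist_le_dist_add_one (s := s) hconn hadj
      have h2 := dist_target_of_mem_connectors hJ hv
      omega
    · exact hd (((connSpec_connectors _ _).chan_eq _ h).symm.trans (hc.trans hchan))
    · exact hr.not_adj v hv hadj
    · exact hd (((domSpec_dominators _ _).chan_eq _ h).symm.trans (hc.trans hchan))
  · rcases hcases e' he' het with h | ⟨d, hd, h⟩ | ⟨h, hr⟩ | ⟨d, hd, h⟩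
    · rw [hn] at h
      omega
    · refine htB (Finset.mem_image.2 ⟨e', Finset.mem_union_right _ ?_, het⟩)
      simp only [hF, otherChannels, Finset.mem_filter, List.mem_toFinset]
      exact ⟨he', hn, d, hd, h⟩
    · exact hr.ne hn
    · have := dist_node_of_mem_dominators h
      rw [hn] at this
      omega

/-- The source is the only connector of layer 0, once per channel at most, so only its own `k - 1`
other transmissions can block a slot. -/
theorem source_slot_le (hconn : G.Connected) (he : e ∈ output G A s τ)
    (hJ : e.1 ∈ connectors G A s τ 0 c) : e.2 ≤ k := by
  obtain ⟨pre, hp⟩ := exists_placedAfter he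
  have hs : ∀ {J d}, J ∈ connectors G A s τ 0 d → J.node = s := fun h =>
    (hconn.dist_eq_zero_iff.1 (dist_node_of_mem_connectors h)).symm
  have hchan := (connSpec_connectors 0 c).chan_eq _ hJ
  have hcases : ∀ e' ∈ (run G A s pre).log, e'.1.chan ≠ c ∧
      (e'.1.node = s → ∃ d ≠ c, e'.1 ∈ connectors G A s τ 0 d) := by
    intro e' he'
    rcases (hp.before he').of_mem_connectors hJ with ⟨j, hj, -⟩ | ⟨d, hd, h⟩ | ⟨h, hr⟩ | ⟨d, hd, h⟩
    · omega
    · exact ⟨fun hc => hd (((connSpec_connectors _ _).chan_eq _ h).symm.trans hc),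
        fun _ => ⟨d, hd, h⟩⟩
    · exact absurd ((hs h).trans (hs hJ).symm) hr.ne
    · refine ⟨fun hc => hd (((domSpec_dominators _ _).chan_eq _ h).symm.trans hc), fun hn => ?_⟩
      have := dist_node_of_mem_dominators h
      rw [hn, SimpleGraph.dist_self] at this
      omega
  set F := otherChannels G A s τ 0 c e.1.node (run G A s pre).log with hF
  have hFcard : F.card ≤ k - 1 := card_otherChannels_le _ fun a ha => hp.mem_output_of_mem ha
  have hk : 1 ≤ k := c.pos
  have hmain : e.2 ≤ 0 + (k - 1) + 1 := ?_
  · omega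
  rw [hp.2]
  refine earliestSlot_le (F.image Prod.snd) (Finset.card_image_le.trans hFcard) fun t ht htB => ?_
  refine ⟨?_, fun w hw hAw hr => ?_, fun v hv e' he' het hc hne hadj => ?_,
    fun e' he' hn hc het => ?_⟩
  · rcases hp.rcv_node hconn with ⟨-, h⟩ | ⟨e', he', hm, h⟩
    · rw [h]
      exact_mod_cast ht
    · rw [hs hJ] at hm
      exact absurd hm (source_notMem_targets (fst_mem_plan (hp.mem_output_of_mem he')))
  · obtain ⟨-, rfl⟩ | ⟨e', he', hm, -⟩ := rcv_run_eq_coe hr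
    · omega
    have hc := chan_of_mem_plan (fst_mem_plan (hp.mem_output_of_mem he')) hm
    exact (hcases e' he').1 (hc.symm.trans (hAw.trans hchan))
  · exact (hcases e' he').1 (hc.trans hchan)
  · refine htB (Finset.mem_image.2 ⟨e', ?_, het⟩)
    simp only [hF, otherChannels, Finset.mem_filter, List.mem_toFinset]
    exact ⟨he', hn, (hcases e' he').2 (hn.trans (hs hJ))⟩

theorem finishTime_le (hG : IsUnitDiskGraph G) (hconn : G.Connected) (i : ℕ) :
    finishTime G A s τ i ≤ k + (k + 23) * i := by
  induction i with
  | zero =>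
    refine lastSlot_le fun e he => ?_
    simp only [List.mem_filter, mem_layer, decide_eq_true_eq] at he
    obtain ⟨j, _, c, hb | hb⟩ := mem_plan.1 (fst_mem_plan he.1)
    · obtain rfl : j = 0 := (dist_node_of_mem_connectors hb).symm.trans he.2
      simpa using source_slot_le hconn he.1 hb
    · have := dist_node_of_mem_dominators hb
      omega
  | succ i ih =>
    refine lastSlot_le fun e he => ?_
    simp only [List.mem_filter, mem_layer, decide_eq_true_eq] at he
    rw [mul_add, mul_one]
    obtain ⟨j, _, c, hb | hb⟩ := mem_plan.1 (fst_mem_plan he.1)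
    · obtain rfl : j = i + 1 := (dist_node_of_mem_connectors hb).symm.trans he.2
      have := connector_slot_le hG hconn he.1 hb
      omega
    · have h1 : j + 1 = i + 1 := (dist_node_of_mem_dominators hb).symm.trans he.2
      obtain rfl : j = i := by omega
      have := dominator_slot_le hG hconn he.1 hb
      omega

/-- A round ends with dominators, at most 20 slots after `finishTime j ≤ k + (k + 23) * j`, and `k +
20 ≤ k + 23`. -/
theorem latency_le (hG : IsUnitDiskGraph G) (hconn : G.Connected) :
    latency G A s τ ≤ (k + 23) * depth G s := by
  refine lastSlot_le fun e he => ?_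
  obtain ⟨j, hj, c, hb⟩ := mem_plan.1 (fst_mem_plan he)
  have h1 := finishTime_le (A := A) (s := s) (τ := τ) hG hconn j
  have h2 : (k + 23) * j + (k + 23) ≤ (k + 23) * depth G s := by
    rw [← Nat.mul_succ]
    exact Nat.mul_le_mul_left _ hj
  rcases hb with hb | hb
  · have := le_finishTime he (dist_node_of_mem_connectors hb)
    omega
  · have := dominator_slot_le hG hconn he hb
    omega

end Latency

end ETS

theorem theorem3 {V : Type*} [Fintype V] (G : SimpleGraph V) (hG : ETS.IsUnitDiskGraph G)
    (hconn : G.Connected) (k : ℕ) (A : V → Fin k) (s : V) (τ : ETS.TieBreak V) :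
    -- a spanning tree of the network is built
    ((ETS.tree G A s τ).IsTree ∧ ETS.tree G A s τ ≤ G) ∧
    -- every node other than the source is assigned to exactly one scheduled transmission
    (∀ v, v ≠ s → ∃! e, e ∈ ETS.output G A s τ ∧ v ∈ e.1.targets) ∧
    -- and all assigned receptions are collision-free
    (∀ e ∈ ETS.output G A s τ, ∀ v ∈ e.1.targets,
      ETS.Receives G A (ETS.schedule G A s τ) e.2 e.1.node v) ∧
    -- the output is a broadcast schedule
    ETS.IsBroadcastSchedule G A s (ETS.schedule G A s τ) (ETS.latency G A s τ) ∧
    -- dominators of layer i + 1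
    (∀ i c, ∀ e ∈ ETS.output G A s τ, e.1 ∈ ETS.dominators G A s τ (i + 1) c →
      e.2 ≤ ETS.finishTime G A s τ i + 20) ∧
    -- connectors in layer i + 1
    (∀ i c, ∀ e ∈ ETS.output G A s τ, e.1 ∈ ETS.connectors G A s τ (i + 1) c →
      e.2 ≤ ETS.finishTime G A s τ i + k + 23) ∧
    -- latency bound
    ETS.latency G A s τ ≤ (k + 23) * ETS.depth G s ∧
    -- approximation ratio with respect to every broadcast schedule
    (∀ (S : ETS.Schedule V k) (T : ℕ), ETS.IsBroadcastSchedule G A s S T →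
      ETS.latency G A s τ ≤ (k + 23) * T) :=
  ⟨⟨ETS.isTree_tree hconn, ETS.tree_le⟩,
    fun _ hv => ETS.existsUnique_mem_output hconn hv,
    fun _ he _ hv => ETS.receives_schedule hconn he hv,
    ETS.isBroadcastSchedule_schedule hconn,
    fun _ _ _ he hJ => ETS.dominator_slot_le hG hconn he hJ,
    fun _ _ _ he hJ => ETS.connector_slot_le hG hconn he hJ,
    ETS.latency_le hG hconn,
    fun _ _ hS => (ETS.latency_le hG hconn).trans (Nat.mul_le_mul_left _ (hS.depth_le hconn))⟩
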